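/- Let $\mathbb F$ be a field of characteristic zero, complete with respect to an absolute value (possibly trivial); $\mathbb F\{X\}$ denotes convergent power series. For a matrix $N$ with rows $N_i$ and a tuple $Z$ write $Z^N=(Z^{N_1},\dots,Z^{N_n})$; products $\alpha\cdot N$ are row vector times matrix; all ranks are over $\mathbb Q$. An exponential matrix of $f\in\mathbb F\{X\}$ at a vertex $A$ of its Newton polyhedron is a matrix over $\mathbb N$ with determinant $\pm1$ such that $A$ lies on the face on which each column is minimal. A Weierstrass polynomial of degree $d$ in $x$ is a series $x^d+\sum_{j=2}^d c_jx^{d-j}$ whose $c_j$ are independent of $x$ and vanish at $0$. First step. Let $w\in\mathbb F\{x_1,\dots,x_n\}$ be a Weierstrass polynomial in $x_1$ of degree $d=\mathrm{ord}(w)>1$, $1\le k<n$, and $M$ an exponential matrix of $w$ at a vertex $A$, with rows ordered $x_2,\dots,x_n,x_1$ and exceptional columns $k+1,\dots,n$. Suppose that $x_1$ is inconsistent, i.e. after deletion of its row the exceptional columns have rank $<n-k$, and that (after relabelling) the submatrix of $M$ with rows $x_{k+2},\dots,x_n,x_1$ and columns $k+1,\dots,n$, and its submatrix $D$ with rows $x_{k+2},\dots,x_n$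 and columns $k+2,\dots,n$, are invertible. Let $N$ be the canonical reduction of $M$ (its first $k$ columns are replaced by $e_1,\dots,e_k$), $N_0$ the exceptional columns of $N$, $N_1$ the exceptional part of the row $x_1$, and $l_0\in\mathbb Q^{n-k-1}$ the vector with $D\,l_0$ equal to column $k+1$ in the rows $x_{k+2},\dots,x_n$. Write $Z=(Z_*,Z_0)$ with $Z_*=(z_1,\dots,z_k)$, and let $q$ be the partial transform: $w(Z^N)=Z_0^{A\cdot N_0}q(Z)$. Let $s\in(\mathbb F^*)^k$ be such that $q$ converges near $(s,0)$ and $q(s,0)=0$, and let $d'$ be the order at $s$ of $q(Z_*,0)$. Let $f(X')$ be obtained from $q$ by localization at $(s,0)$, an invertible linear change of the localized variables $Z_*-s$ to new variables $X'_*=(x'_1,\dots,x'_k)$, with $X'_0=Z_0$ kept, and a substitution $x'_1\mapsto x'_1-h$ with $h\in\mathbb F\{X'\}$ independent of $x'_1$ and $h(0)=0$. The latent component of an exponent $(\alpha'_*,\alpha'_0)$ of $X'$ is the number $a$ in the unique expression $\alpha'_0=v\cdot[\,l_0\ E\,]+aN_1$. Suppose that all terms of $h$ have latent component $0$ and that the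 sum $f_0$ of the terms of $f$ of latent component $0$ has, within the algebra of convergent series with latent components $0$, a Weierstrass form $f_0=w'\,(c+r)$, where $w'$ is a Weierstrass polynomial of degree $d'$ in $x'_1$, $c\in\mathbb F^*$, $r(0)=0$. Let $S$ be the matrix with columns $e_1,\dots,e_k$, then columns $k+2,\dots,n$ of $N$ with the entries in the row $x_1$ replaced by $0$, then the unit vector of the row $x_1$. Let $\hat T=\begin{bmatrix}E_k&0\\0&\begin{smallmatrix}l_0\ \ E\\ N_1\end{smallmatrix}\end{bmatrix}$, whose rows correspond to the variables $(X'_*,\zeta,x_1)$, $\zeta=(\zeta_{k+2},\dots,\zeta_n)$, and whose columns correspond to $X'$. The interim transform $f(X'_*,\zeta,x_1)$ is obtained from $w((Z_*,\zeta,x_1)^S)$ by the same localization of $Z_*$, linear change and substitution ($h$ being rewritten in $X'_*,\zeta$ by means of $(X'_*,\zeta,x_1)=X'^{\hat T}$). Second step. Let $k\le l<n$ and let $M'$ be an exponential matrix of $f(X')$ at a vertex $A'$, with exceptional columns $l+1,\dots,n$, such that $x'_1$ is consistent with it (after deletion of its row the exceptional columns still have rank $n-l$) and such that, after relabelling of $x'_{k+1},\dots,x'_n$,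 the exceptional columns of $M'$ in the rows $x'_{l+1},\dots,x'_n$ form an invertible matrix. Let $N'$ be the canonical reduction of $M'$ (its first $l$ columns are replaced by $e_1,\dots,e_l$) and $Q'=\hat T N'$ the synthetic matrix. Suppose that $x_1$ sustains its latency: after deletion of the row $x_1$ the exceptional columns of $Q'$ have rank $<n-l$. Relabel the $\zeta$'s so that the last $n-l$ rows of $Q'$, which are $\zeta_{l+2},\dots,\zeta_n,x_1$, are linearly independent in the exceptional columns, and let $N_{Q'}$ be the canonical reduction of $Q'$ (its first $l$ columns are replaced by $e_1,\dots,e_l$; the exceptional columns are kept). Put $(X'_*,\zeta,x_1)=T'^{N_{Q'}}$, $T'=(T'_*,T'_0)$, $T'_*=(t'_1,\dots,t'_l)$, so that $t'_1$ corresponds to $x'_1$, and let $p(T')$ be the partial transform of $f(X'_*,\zeta,x_1)$, that is, its transform divided by the power of $T'_0$ that belongs to $A'$. Then the singularity height associated with $t'_1$ is smaller than $d'$ at every regular point, after a deficient contraction. Precisely: there is $\delta>0$ such that for every $t\in(\mathbb F^*)^l$ for which $|x'_j|<\delta$ at $(t,0)$ for all $j$ for which the $j$-th row of $N'$ vanishes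 in the exceptional columns (for such $j$ the value $|x'_j|$ is well defined on $T'_0=0$ by $X'^{\hat T}=T'^{N_{Q'}}$, and if there is no such $j$ there is no condition), the series $p$ converges near $(t,0)$, and if the localized proper transform $p_*(\tilde T'_*)=p(\tilde T'_*+t,0)$ satisfies $p_*(\tilde t'_1,0,\dots,0)\neq0$ (regularity), then $$\mathrm{ord}\,p_*(\tilde t'_1,0,\dots,0)<d'\qquad\text{and}\qquad\mathrm{ord}\,p_*(\tilde T'_*)<d'.$$ -/

import Mathlib

open scoped Pointwise

noncomputable section

namespace LatentResolution

/-! ### Power series, supports, Newton polyhedra -/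

section Series

variable {F : Type*} [NormedField F] {ν σ τ : Type*}

/-- The power series `f` converges absolutely in some polydisc around the point `s`. -/
def ConvergesAt [Fintype ν] (f : MvPowerSeries ν F) (s : ν → F) : Prop :=
  ∃ ρ : ℝ, 0 < ρ ∧
    Summable fun α : ν →₀ ℕ => ‖MvPowerSeries.coeff α f‖ * ∏ i, (‖s i‖ + ρ) ^ α i

/-- `f` is a convergent power series, an element of `F{X}`. -/
def Convergent [Fintype ν] (f : MvPowerSeries ν F) : Prop :=
  ConvergesAt f 0

/-- An exponent vector as a point of real space. -/
def toReal (α : ν →₀ ℕ) : ν → ℝ := fun i => (α i : ℝ)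

/-- An exponent vector as a rational vector. -/
def toRat (α : ν →₀ ℕ) : ν → ℚ := fun i => (α i : ℚ)

/-- The Newton polyhedron: convex hull of the support plus the nonnegative orthant. -/
def newtonPolyhedron (f : MvPowerSeries ν F) : Set (ν → ℝ) :=
  convexHull ℝ (toReal '' {α : ν →₀ ℕ | MvPowerSeries.coeff α f ≠ 0}) + {v | 0 ≤ v}

/-- The face of `P` cut out by the vector `W`: the points of `P` minimizing `⟨W, ·⟩`. -/
def face [Fintype ν] (P : Set (ν → ℝ)) (W : ν → ℝ) : Set (ν → ℝ) :=
  {a | a ∈ P ∧ ∀ b ∈ P, W ⬝ᵥ a ≤ W ⬝ᵥ b}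

/-- `M` is an exponential matrix of a (refined) vertex cone of the Newton polyhedron of `f` at the
vertex `A`: its columns are nonnegative integral vectors that lie in the vertex cone of `A`, that is,
`A` lies on the face cut out by each of them, and `|det M| = 1`. (The rows carry the variables of `f`,
the columns carry the new variables; the sign of the determinant depends on the labelling.) -/
structure IsExponentialMatrix [Fintype ν] [DecidableEq ν] (f : MvPowerSeries ν F)
    (A : ν →₀ ℕ) (M : Matrix ν σ ℕ) : Prop where
  vertex : toReal A ∈ (newtonPolyhedron f).extremePoints ℝ
  mem_face : ∀ j, toReal A ∈ face (newtonPolyhedron f) (fun i => (M i j : ℝ))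
  unimodular : ∃ e : ν ≃ σ, |((M.submatrix id e).map (Nat.cast : ℕ → ℤ)).det| = 1

/-- `w = x_i ^ d + ∑_{j = 2}^d c_j x_i ^ (d - j)`, where the `c_j` do not involve `x_i` and vanish at
the origin; there is no term of degree `d - 1` in `x_i`. -/
def IsWeierstrassPolynomial [DecidableEq ν] (i : ν) (d : ℕ) (w : MvPowerSeries ν F) : Prop :=
  ∃ c : ℕ → MvPowerSeries ν F,
    (∀ j ∈ Finset.Icc 2 d, MvPowerSeries.constantCoeff (c j) = 0 ∧
      ∀ α : ν →₀ ℕ, MvPowerSeries.coeff α (c j) ≠ 0 → α i = 0) ∧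
    w = MvPowerSeries.X i ^ d + ∑ j ∈ Finset.Icc 2 d, c j * MvPowerSeries.X i ^ (d - j)

/-! ### Monomial transformations; exceptional variables are indexed by `τ`, the others by `σ` -/

/-- The partial transform of `f` under the monomial transformation `x_i = ∏_j z_j ^ (N i j)` when the
exceptional factor `∏_{j ∈ τ} z_j ^ (a j)` is removed: the term `c x^α` becomes the term with
coefficient `c` and exponent `α N - (0, a)`. (The matrices `N` used below are invertible, so at most one
`α` contributes to each coefficient.) -/
def partialTransform [Fintype ν] (N : Matrix ν (σ ⊕ τ) ℚ) (a : τ → ℚ) (f : MvPowerSeries ν F) :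
    MvPowerSeries (σ ⊕ τ) F :=
  fun γ => ∑ᶠ (α : ν →₀ ℕ)
    (_ : Matrix.vecMul (toRat α) N = toRat γ + Sum.elim (0 : σ → ℚ) a), MvPowerSeries.coeff α f

/-- The localization `f(z_* + s, z_0)`, expanded in powers of the localized variables. -/
def localize [Fintype σ] (s : σ → F) (f : MvPowerSeries (σ ⊕ τ) F) : MvPowerSeries (σ ⊕ τ) F :=
  fun γ => ∑' η : σ →₀ ℕ,
    MvPowerSeries.coeff (Finsupp.sumElim η (Finsupp.sumFinsuppEquivProdFinsupp γ).2) f *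
      ∏ i, ((η i).choose (γ (Sum.inl i)) : F) * s i ^ (η i - γ (Sum.inl i))

/-- The restriction `f(z_*, 0)` to the locus where all exceptional variables vanish. -/
def proper (f : MvPowerSeries (σ ⊕ τ) F) : MvPowerSeries σ F :=
  fun η => MvPowerSeries.coeff (Finsupp.sumElim η 0) f

/-- The univariate series `f(0, …, z_i, …, 0)`. -/
def onAxis (i : σ) (f : MvPowerSeries σ F) : PowerSeries F :=
  PowerSeries.mk fun m => MvPowerSeries.coeff (Finsupp.single i m) f

/-- `(s, 0)` is a branch point of the partial transform `q`: the coordinates of `s` are nonzero, `q`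
converges near `(s, 0)` and `q(s, 0) = 0`. -/
structure IsBranchPoint [Fintype σ] [Fintype τ] (q : MvPowerSeries (σ ⊕ τ) F) (s : σ → F) :
    Prop where
  ne_zero : ∀ i, s i ≠ 0
  converges : ConvergesAt q (Sum.elim s 0)
  vanishes : MvPowerSeries.constantCoeff (proper (localize s q)) = 0

/-- The change of variables `z̃_i = ∑_j g_{ij} x'_j` on the non-exceptional variables, followed by
`x'_1 ↦ x'_1 - h` (the completion of the perfect power); exceptional variables are kept. -/
def reduce [Fintype σ] [DecidableEq σ] (i₁ : σ) (g : Matrix σ σ F) (h : MvPowerSeries (σ ⊕ τ) F)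
    (f : MvPowerSeries (σ ⊕ τ) F) : MvPowerSeries (σ ⊕ τ) F :=
  MvPowerSeries.subst
    (Sum.elim
      (fun i => ∑ j, g i j • (MvPowerSeries.X (Sum.inl j) - if j = i₁ then h else 0))
      (fun e => MvPowerSeries.X (Sum.inr e)) : σ ⊕ τ → MvPowerSeries (σ ⊕ τ) F) f

end Series

/-! ### Canonical reduction and consistency -/

section Matrices

variable {ν σ τ : Type*}

/-- The exceptional submatrix of `M` with respect to a labelling `e` of the rows by the columns. -/
def excSubmatrix (e : ν ≃ σ ⊕ τ) (M : Matrix ν (σ ⊕ τ) ℚ) : Matrix τ τ ℚ :=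
  M.submatrix (fun j => e.symm (Sum.inr j)) Sum.inr

/-- The canonical reduction of `M`: the non-exceptional columns are replaced by standard basis vectors
(`E` over `O`, for the rows labelled non-exceptional and exceptional); the exceptional columns are kept. -/
def canonicalReduction [DecidableEq σ] [DecidableEq τ] (e : ν ≃ σ ⊕ τ) (M : Matrix ν (σ ⊕ τ) ℚ) :
    Matrix ν (σ ⊕ τ) ℚ :=
  Matrix.of fun i => Sum.elim (fun j => if e i = Sum.inl j then 1 else 0) (fun j => M i (Sum.inr j))

/-- The variable of the row `x` is consistent with `M` and the exceptional columns `τ`: after deletion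
of that row the exceptional columns still have full rank. -/
def IsConsistent [Fintype τ] (M : Matrix ν (σ ⊕ τ) ℚ) (x : ν) : Prop :=
  (M.submatrix (Subtype.val : {i : ν // i ≠ x} → ν) Sum.inr).rank = Fintype.card τ

end Matrices

/-! ### The first, inconsistent step

`κ` indexes the `k` non-exceptional variables and `Option ι` the `n - k` exceptional ones. The rows
of `M` (the old variables) are labelled `inl i` (`x_2, …, x_{k+1}`), `inr (some e)` (`x_{k+2}, …, x_n`) and
`inr none` (the primary variable `x_1`); its columns are labelled `inl i` (`z_1, …, z_k`), `inr none`
(`z_{k+1}`) and `inr (some e)` (`z_{k+2}, …, z_n`). The variables `X'` are labelled as the columns. The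
synthetic variables are `inl i` (`x'_1, …, x'_k`), `inr (some e)` (`ζ_e`) and `inr none` (`x_1`). -/

section FirstStep

variable {F : Type*} [NormedField F] {κ ι : Type*}
  [Fintype κ] [DecidableEq κ] [Fintype ι] [DecidableEq ι]

/-- Entries of `M` in the rational numbers. -/
def ratMatrix {ν ν' : Type*} (M : Matrix ν ν' ℕ) : Matrix ν ν' ℚ := M.map (Nat.cast : ℕ → ℚ)

/-- The block `D`: rows `x_{k+2}, …, x_n`, columns `z_{k+2}, …, z_n`. -/
def blockD (M : Matrix (κ ⊕ Option ι) (κ ⊕ Option ι) ℕ) : Matrix ι ι ℚ :=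
  (ratMatrix M).submatrix (fun e => Sum.inr (some e)) (fun e => Sum.inr (some e))

/-- The vector `l` for which the column `z_{k+1}` of the rows `x_{k+2}, …, x_n` is `D l`. -/
def vecL (M : Matrix (κ ⊕ Option ι) (κ ⊕ Option ι) ℕ) : ι → ℚ :=
  Matrix.mulVec (blockD M)⁻¹ fun e => (M (Sum.inr (some e)) (Sum.inr none) : ℚ)

/-- The exceptional part `N_1` of the primary row. -/
def primaryRow (M : Matrix (κ ⊕ Option ι) (κ ⊕ Option ι) ℕ) : Option ι → ℚ :=
  fun j => (M (Sum.inr none) (Sum.inr j) : ℚ)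

/-- The canonical reduction `N` of `M` (with the row `x_1` labelled as exceptional). -/
def reducedMatrix (M : Matrix (κ ⊕ Option ι) (κ ⊕ Option ι) ℕ) :
    Matrix (κ ⊕ Option ι) (κ ⊕ Option ι) ℚ :=
  canonicalReduction (Equiv.refl _) (ratMatrix M)

/-- The interim matrix `S`: the columns `z_1, …, z_k` of `N`, the columns `ζ_e`, which are the columns
`z_{k+2}, …, z_n` of `N` with the entries in the row `x_1` replaced by `0`, and the unit column of `x_1`. -/
def interimS (M : Matrix (κ ⊕ Option ι) (κ ⊕ Option ι) ℕ) :
    Matrix (κ ⊕ Option ι) (κ ⊕ Option ι) ℚ :=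
  Matrix.of fun i j => match j with
    | Sum.inl j => if i = Sum.inl j then 1 else 0
    | Sum.inr (some e) => if i = Sum.inr none then 0 else (M i (Sum.inr (some e)) : ℚ)
    | Sum.inr none => if i = Sum.inr none then 1 else 0

/-- The interim matrix `T̂`, with rows the synthetic variables and columns `X'`: unit block on `κ`,
rows `[l E]` for the `ζ_e`, and the row `N_1` for `x_1`. -/
def interimT (M : Matrix (κ ⊕ Option ι) (κ ⊕ Option ι) ℕ) :
    Matrix (κ ⊕ Option ι) (κ ⊕ Option ι) ℚ :=
  Matrix.fromBlocks 1 0 0 <| Matrix.of fun i j => match i, j with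
    | some e, none => vecL M e
    | some e, some e' => if e = e' then 1 else 0
    | none, j => primaryRow M j

/-- The exponents `A N` of the exceptional factor of the first step. -/
def excFactor (M : Matrix (κ ⊕ Option ι) (κ ⊕ Option ι) ℕ) (A : (κ ⊕ Option ι) →₀ ℕ) :
    Option ι → ℚ :=
  fun j => Matrix.vecMul (toRat A) (reducedMatrix M) (Sum.inr j)

/-- The latent primary component of an exponent of `X'`: its exceptional part is uniquely
`v [l E] + a N_1`, and pairing with `(-1, l)` gives `a`. -/
def latentComponent (M : Matrix (κ ⊕ Option ι) (κ ⊕ Option ι) ℕ) (α : (κ ⊕ Option ι) →₀ ℕ) : ℚ :=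
  (-(α (Sum.inr none) : ℚ) + ∑ e, (α (Sum.inr (some e)) : ℚ) * vecL M e) /
    (-primaryRow M none + ∑ e, primaryRow M (some e) * vecL M e)

/-- All terms of `f` have latent primary component zero. -/
def LatentZero (M : Matrix (κ ⊕ Option ι) (κ ⊕ Option ι) ℕ)
    (f : MvPowerSeries (κ ⊕ Option ι) F) : Prop :=
  ∀ α, MvPowerSeries.coeff α f ≠ 0 → latentComponent M α = 0

/-- The latent reducible function `f_0`: the sum of the terms of `f` of latent primary component zero. -/
def latentReducible (M : Matrix (κ ⊕ Option ι) (κ ⊕ Option ι) ℕ)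
    (f : MvPowerSeries (κ ⊕ Option ι) F) : MvPowerSeries (κ ⊕ Option ι) F :=
  fun α => if latentComponent M α = 0 then MvPowerSeries.coeff α f else 0

/-- A series `h(X')` of latent component zero, rewritten in the synthetic variables by means of
`(Ξ', x_1) = X' ^ T̂`. -/
def toSynthetic (M : Matrix (κ ⊕ Option ι) (κ ⊕ Option ι) ℕ)
    (h : MvPowerSeries (κ ⊕ Option ι) F) : MvPowerSeries (κ ⊕ Option ι) F :=
  fun α => ∑ᶠ (α' : (κ ⊕ Option ι) →₀ ℕ)
    (_ : Matrix.vecMul (toRat α) (interimT M) = toRat α'), MvPowerSeries.coeff α' h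

/-- The setting of the first step: `w` is a convergent Weierstrass polynomial of singularity height
`d = ord w > 1` in the primary variable `x_1`, `M` is an exponential matrix of its Newton polyhedron at
the vertex `A`, `x_1` is inconsistent with `M` and the exceptional columns, and the labelling is
canonical. -/
structure IsInconsistentStep (w : MvPowerSeries (κ ⊕ Option ι) F) (d : ℕ)
    (A : (κ ⊕ Option ι) →₀ ℕ) (M : Matrix (κ ⊕ Option ι) (κ ⊕ Option ι) ℕ) : Prop where
  convergent : Convergent w
  one_lt : 1 < d
  order_eq : w.order = d
  weierstrass : IsWeierstrassPolynomial (Sum.inr none) d w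
  exponential : IsExponentialMatrix w A M
  inconsistent : ¬ IsConsistent (ratMatrix M) (Sum.inr none)
  det_exc : (excSubmatrix (Equiv.refl _) (ratMatrix M)).det ≠ 0
  det_D : (blockD M).det ≠ 0

/-- The partial transform `q(Z)` of `w` under the canonical reduction `N`. -/
def firstTransform (w : MvPowerSeries (κ ⊕ Option ι) F) (A : (κ ⊕ Option ι) →₀ ℕ)
    (M : Matrix (κ ⊕ Option ι) (κ ⊕ Option ι) ℕ) : MvPowerSeries (κ ⊕ Option ι) F :=
  partialTransform (reducedMatrix M) (excFactor M A) w

/-- The latent apex form `f(X')`: localization of `q` at `(s, 0)`, linear modification `g`, completion of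
the perfect power by `h`. -/
def latentForm (w : MvPowerSeries (κ ⊕ Option ι) F) (A : (κ ⊕ Option ι) →₀ ℕ)
    (M : Matrix (κ ⊕ Option ι) (κ ⊕ Option ι) ℕ) (s : κ → F) (i₁ : κ) (g : Matrix κ κ F)
    (h : MvPowerSeries (κ ⊕ Option ι) F) : MvPowerSeries (κ ⊕ Option ι) F :=
  reduce i₁ g h (localize s (firstTransform w A M))

/-- The interim transform `f(Ξ', x_1)`: the total transform of `w` under `S`, followed by the same
localization, linear modification and completion of the perfect power. -/
def interimTransform (w : MvPowerSeries (κ ⊕ Option ι) F)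
    (M : Matrix (κ ⊕ Option ι) (κ ⊕ Option ι) ℕ) (s : κ → F) (i₁ : κ) (g : Matrix κ κ F)
    (h : MvPowerSeries (κ ⊕ Option ι) F) : MvPowerSeries (κ ⊕ Option ι) F :=
  reduce i₁ g (toSynthetic M h) (localize s (partialTransform (interimS M) 0 w))

/-- The data `s, g, h` define latent preliminary and Weierstrass reductions with primary variable
`x'_1` (index `inl i₁`) and singularity height `d'`: `s` is a branch point, `d'` is the order of the
localized proper transform, `g` is invertible, `h` does not involve `x'_1`, and the latent reducible function
of `f` has a Weierstrass form `w' (c + r)` of degree `d'`. The Weierstrass reduction takes place in the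
algebra of convergent series of latent primary component zero. -/
structure IsLatentReduction (w : MvPowerSeries (κ ⊕ Option ι) F) (A : (κ ⊕ Option ι) →₀ ℕ)
    (M : Matrix (κ ⊕ Option ι) (κ ⊕ Option ι) ℕ) (s : κ → F) (i₁ : κ) (g : Matrix κ κ F)
    (h : MvPowerSeries (κ ⊕ Option ι) F) (d' : ℕ) : Prop where
  branch : IsBranchPoint (firstTransform w A M) s
  height : (proper (localize s (firstTransform w A M))).order = d'
  det_g : g.det ≠ 0
  h_const : MvPowerSeries.constantCoeff h = 0
  h_indep : ∀ α, MvPowerSeries.coeff α h ≠ 0 → α (Sum.inl i₁) = 0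
  h_conv : Convergent h
  h_latent : LatentZero M h
  f_conv : Convergent (latentForm w A M s i₁ g h)
  weierstrass : ∃ (c : F) (w' r : MvPowerSeries (κ ⊕ Option ι) F), c ≠ 0 ∧
    IsWeierstrassPolynomial (Sum.inl i₁) d' w' ∧ MvPowerSeries.constantCoeff r = 0 ∧
    Convergent w' ∧ Convergent r ∧ LatentZero M w' ∧ LatentZero M r ∧
    latentReducible M (latentForm w A M s i₁ g h) = w' * (MvPowerSeries.C c + r)

end FirstStep

/-! ### The second step and the synthesis

`κ ⊕ μ` indexes the `l` non-exceptional variables and `θ` the `n - l` exceptional variables of the second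
step. A bijection `Option ι ≃ μ ⊕ θ` says which rows are labelled non-exceptional and which exceptional. -/

section SecondStep

variable {F : Type*} [NormedField F] {κ ι μ θ : Type*}
  [Fintype κ] [DecidableEq κ] [Fintype ι] [DecidableEq ι]
  [Fintype μ] [DecidableEq μ] [Fintype θ] [DecidableEq θ]

/-- The labelling of the rows obtained from a labelling of `Option ι`; the rows in `κ` are
non-exceptional. -/
def rowLabels (ρ : Option ι ≃ μ ⊕ θ) : κ ⊕ Option ι ≃ (κ ⊕ μ) ⊕ θ :=
  ((Equiv.refl κ).sumCongr ρ).trans (Equiv.sumAssoc κ μ θ).symm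

/-- The synthetic exponential matrix `Q' = T̂ N'`. -/
def syntheticMatrix (M : Matrix (κ ⊕ Option ι) (κ ⊕ Option ι) ℕ)
    (M' : Matrix (κ ⊕ Option ι) ((κ ⊕ μ) ⊕ θ) ℕ) (ρ : Option ι ≃ μ ⊕ θ) :
    Matrix (κ ⊕ Option ι) ((κ ⊕ μ) ⊕ θ) ℚ :=
  interimT M * canonicalReduction (rowLabels ρ) (ratMatrix M')

/-- The canonical reduction `N_{Q'}` of the synthetic matrix, with the labelling `π` of the rows. -/
def syntheticReduced (M : Matrix (κ ⊕ Option ι) (κ ⊕ Option ι) ℕ)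
    (M' : Matrix (κ ⊕ Option ι) ((κ ⊕ μ) ⊕ θ) ℕ) (ρ π : Option ι ≃ μ ⊕ θ) :
    Matrix (κ ⊕ Option ι) ((κ ⊕ μ) ⊕ θ) ℚ :=
  canonicalReduction (rowLabels π) (syntheticMatrix M M' ρ)

/-- The setting of the second step: `M'` is an exponential matrix of the Newton polyhedron of `f(X')` at
the vertex `A'` in canonical consistency form with respect to the primary variable `x'_1`. -/
structure IsConsistentStep (f : MvPowerSeries (κ ⊕ Option ι) F) (i₁ : κ)
    (A' : (κ ⊕ Option ι) →₀ ℕ) (M' : Matrix (κ ⊕ Option ι) ((κ ⊕ μ) ⊕ θ) ℕ)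
    (ρ : Option ι ≃ μ ⊕ θ) : Prop where
  exponential : IsExponentialMatrix f A' M'
  consistent : IsConsistent (ratMatrix M') (Sum.inl i₁)
  det_exc : (excSubmatrix (rowLabels ρ) (ratMatrix M')).det ≠ 0

/-- The latent primary variable `x_1` sustains its latency: it is inconsistent with `Q'` and the
exceptional columns; `π` labels the row `x_1` as exceptional and the exceptional submatrix of `Q'` is
nondegenerate. -/
structure SustainsLatency (M : Matrix (κ ⊕ Option ι) (κ ⊕ Option ι) ℕ)
    (M' : Matrix (κ ⊕ Option ι) ((κ ⊕ μ) ⊕ θ) ℕ) (ρ π : Option ι ≃ μ ⊕ θ) : Prop where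
  inconsistent : ¬ IsConsistent (syntheticMatrix M M' ρ) (Sum.inr none)
  label : ∃ j : θ, π none = Sum.inr j
  det_exc : (excSubmatrix (rowLabels π) (syntheticMatrix M M' ρ)).det ≠ 0

/-- The partial transform of the interim transform `fI` under `N_{Q'}`. The vertex of `fI` that
corresponds to `A'` is the `B` with `B T̂ = A' + (0, A N)`, and the exceptional factor has the exponents
`B Q' = (A' + (0, A N)) N'` in the exceptional columns. -/
def syntheticTransform (fI : MvPowerSeries (κ ⊕ Option ι) F) (A A' : (κ ⊕ Option ι) →₀ ℕ)
    (M : Matrix (κ ⊕ Option ι) (κ ⊕ Option ι) ℕ) (M' : Matrix (κ ⊕ Option ι) ((κ ⊕ μ) ⊕ θ) ℕ)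
    (ρ π : Option ι ≃ μ ⊕ θ) : MvPowerSeries ((κ ⊕ μ) ⊕ θ) F :=
  partialTransform (syntheticReduced M M' ρ π)
    (fun j => Matrix.vecMul (toRat A' + Sum.elim (0 : κ → ℚ) (excFactor M A))
      (canonicalReduction (rowLabels ρ) (ratMatrix M')) (Sum.inr j)) fI

/-- The indices of the zero rows of the exceptional columns of `N'`. -/
def IsDeficient (M' : Matrix (κ ⊕ Option ι) ((κ ⊕ μ) ⊕ θ) ℕ) (j : κ ⊕ Option ι) : Prop :=
  ∀ e : θ, M' j (Sum.inr e) = 0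

/-- The absolute value of the coordinate `x'_j` at `T' = (t, 0)`, for a deficient index `j`: as
`X' ^ T̂ = (Ξ', x_1) = T' ^ N_{Q'}`, the exponents of `x'_j` in `T'` are the `j`-th row of `T̂⁻¹ N_{Q'}`,
which vanishes in the exceptional columns. -/
def modulus (M : Matrix (κ ⊕ Option ι) (κ ⊕ Option ι) ℕ)
    (M' : Matrix (κ ⊕ Option ι) ((κ ⊕ μ) ⊕ θ) ℕ) (ρ π : Option ι ≃ μ ⊕ θ)
    (t : κ ⊕ μ → F) (j : κ ⊕ Option ι) : ℝ :=
  ∏ m, ‖t m‖ ^ ((((interimT M)⁻¹ * syntheticReduced M M' ρ π) j (Sum.inl m) : ℚ) : ℝ)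

end SecondStep

end LatentResolution

end

/-!
The terms of the latent apex form `f(X')`, of the interim transform and of the synthetic transform `p(T')`
are in bijection. On exponents the first two differ by the affine map `β ↦ β T̂ - (0, A N)`, because
`N = S T̂` by the inconsistency of `x_1`. Localization, linear changes and the substitution by `h` act
on the correspondence term by term, as `h` has latent component zero and can be rewritten in the
synthetic variables (`Corresponds`, `Corresponds.reduce`, `interimTransform_corresponds`). It is proved for
coefficients extended by zero to rational exponents, where `T̂` is bijective and all convolution formulas
can be reindexed. The step from the interim transform to `p` is one further affine map (`IsMatched`), and
`γ_0 = (α - A') M'_0` for the exceptional part `γ_0` of an exponent of `p`, `M'_0` being the exceptional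
columns of `M'`.

Convergence: if `T'` runs through a small polydisc around `(t, 0)`, then the coordinates `x'_j` that contain
an exceptional variable become arbitrarily small and the deficient ones have almost the absolute values
at `(t, 0)`. So all of them lie in the polydisc of convergence of `f` if `δ` is small
(`exists_radius`, `convergesAt_syntheticTransform`).

Order: `p(T'_*, 0)` is made of the terms of `f` on the face cut out by `M'_0`. The leading power `x'_1 ^ d'`
occurs in `f`, by the Weierstrass form. If it is not on the face, then all terms of the face have degree
less than `d'` in `x'_1`, and so has `p(T'_*, 0)` in `t'_1`. If it is on the face, then all terms of the face
have latent component zero, because `x_1` sustains its latency (`latentComponent_eq_zero_of_face`); hence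
the face belongs to `f_0 = w' (c + r)` and is the product of the faces of `w'` and of `c + r`. The latter
involves deficient variables only and does not vanish for small `δ` (`coeff_zero_axisSum_unit_ne_zero`).
The former is, along the axis, a polynomial in `t'_1` of degree `d'` without a term of degree `d' - 1`; in
characteristic zero it is not a constant multiple of a `d'`-th power of `t'_1 - t_1` with `t_1 ≠ 0`
(`coeff_axisSum_weierstrass_ne_zero`), so its order at `t_1` is less than `d'`.
-/

set_option linter.unusedSectionVars false

namespace LatentResolution

/-! ### Rational exponents -/

theorem toRat_injective {ν : Type*} : Function.Injective (toRat : (ν →₀ ℕ) → ν → ℚ) := by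
  intro α β h
  ext i
  exact Nat.cast_injective (congrFun h i : (α i : ℚ) = β i)

theorem toRat_add {ν : Type*} (α β : ν →₀ ℕ) : toRat (α + β) = toRat α + toRat β := by
  ext i; simp [toRat]

theorem toRat_sub {ν : Type*} {α β : ν →₀ ℕ} (h : β ≤ α) :
    toRat (α - β) = toRat α - toRat β := by
  ext i; simp [toRat, Nat.cast_sub (h i)]

theorem toRat_sumElim {σ τ : Type*} (α : σ →₀ ℕ) (β : τ →₀ ℕ) :
    toRat (Finsupp.sumElim α β) = Sum.elim (toRat α) (toRat β) := by
  ext i; cases i <;> simp [toRat]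

theorem exists_toRat_eq {ν : Type*} [Finite ν] {q : ν → ℚ} (h : ∀ i, ∃ n : ℕ, (n : ℚ) = q i) :
    ∃ α : ν →₀ ℕ, toRat α = q := by
  choose n hn using h
  exact ⟨Finsupp.equivFunOnFinite.symm n, funext fun i => by simp [toRat, hn]⟩

open Classical in
/-- The extension by zero of a family of coefficients, indexed by natural exponents, to rational
exponents. Monomial transformations with rational matrices act on such families by an affine
bijection of the index set, without side conditions. -/
noncomputable def ratExt {F ν : Type*} [Zero F] (c : (ν →₀ ℕ) → F) (q : ν → ℚ) : F :=
  if h : ∃ β, toRat β = q then c h.choose else 0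

section RatExt

variable {F ν K : Type*}

theorem ratExt_toRat [Zero F] (c : (ν →₀ ℕ) → F) (β : ν →₀ ℕ) : ratExt c (toRat β) = c β := by
  have h : ∃ β', toRat β' = toRat β := ⟨β, rfl⟩
  rw [ratExt, dif_pos h, toRat_injective h.choose_spec]

theorem ratExt_of_not_exists [Zero F] (c : (ν →₀ ℕ) → F) {q : ν → ℚ} (h : ¬∃ β, toRat β = q) :
    ratExt c q = 0 :=
  dif_neg h

theorem exists_of_ratExt_ne_zero [Zero F] {c : (ν →₀ ℕ) → F} {q : ν → ℚ} (h : ratExt c q ≠ 0) :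
    ∃ β, toRat β = q ∧ c β = ratExt c q := by
  by_cases hq : ∃ β, toRat β = q
  · obtain ⟨β, rfl⟩ := hq
    exact ⟨β, rfl, (ratExt_toRat c β).symm⟩
  · exact absurd (ratExt_of_not_exists c hq) h

theorem ratExt_map {G : Type*} [Zero F] [Zero G] (φ : F → G) (hφ : φ 0 = 0) (c : (ν →₀ ℕ) → F)
    (q : ν → ℚ) : ratExt (fun β => φ (c β)) q = φ (ratExt c q) := by
  by_cases hq : ∃ β, toRat β = q
  · obtain ⟨β, rfl⟩ := hq
    rw [ratExt_toRat, ratExt_toRat]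
  · rw [ratExt_of_not_exists _ hq, ratExt_of_not_exists _ hq, hφ]

theorem ratExt_zero [Zero F] (q : ν → ℚ) : ratExt (fun _ => (0 : F)) q = 0 := by
  by_cases hq : ∃ β, toRat β = q
  · obtain ⟨β, rfl⟩ := hq
    rw [ratExt_toRat]
  · rw [ratExt_of_not_exists _ hq]

theorem finsum_comp_of_support_subset_range {α β M : Type*} [AddCommMonoid M] (j : α → β)
    (hj : Function.Injective j) (f : β → M) (hf : Function.support f ⊆ Set.range j) :
    ∑ᶠ b, f b = ∑ᶠ a, f (j a) := by
  rw [← finsum_mem_range hj, ← finsum_mem_univ]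
  refine finsum_mem_inter_support_eq f _ _ ?_
  rw [Set.univ_inter, Set.inter_eq_right.2 hf]

open Classical in
/-- A convolution in the exponents, with a parameter `k` on which both factors may depend. Products and
substitutions of power series are of this form. -/
noncomputable def conv [Semiring F] (f g : K → (ν →₀ ℕ) → F) (β : ν →₀ ℕ) : F :=
  ∑ᶠ x : K × (ν →₀ ℕ), f x.1 x.2 * if x.2 ≤ β then g x.1 (β - x.2) else 0

theorem ratExt_conv [Semiring F] (f g : K → (ν →₀ ℕ) → F) (q : ν → ℚ) :
    ratExt (conv f g) q =
      ∑ᶠ x : K × (ν → ℚ), ratExt (f x.1) x.2 * ratExt (g x.1) (q - x.2) := by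
  by_cases hq : ∃ β, toRat β = q
  · obtain ⟨β, rfl⟩ := hq
    rw [ratExt_toRat, conv, finsum_comp_of_support_subset_range
      (Prod.map id toRat : K × (ν →₀ ℕ) → K × (ν → ℚ))
      (Function.injective_id.prodMap toRat_injective)]
    · refine finsum_congr fun x => ?_
      simp only [Prod.map_fst, Prod.map_snd, id, ratExt_toRat]
      congr 1
      split_ifs with hx
      · rw [← toRat_sub hx, ratExt_toRat]
      · rw [ratExt_of_not_exists]
        rintro ⟨δ, hδ⟩
        apply hx
        intro i
        have := congrFun hδ i
        simp only [toRat, Pi.sub_apply] at this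
        have h2 : (x.2 i : ℚ) ≤ β i := by
          have : (0 : ℚ) ≤ δ i := Nat.cast_nonneg _
          linarith
        exact_mod_cast h2
    · rintro ⟨k, r⟩ hr
      obtain ⟨β', hβ', -⟩ := exists_of_ratExt_ne_zero (left_ne_zero_of_mul hr)
      exact ⟨(k, β'), by simp [hβ']⟩
  · rw [ratExt_of_not_exists _ hq]
    symm
    refine finsum_eq_zero_of_forall_eq_zero fun x => ?_
    by_contra hx
    obtain ⟨β, hβ, -⟩ := exists_of_ratExt_ne_zero (left_ne_zero_of_mul hx)
    obtain ⟨δ, hδ, -⟩ := exists_of_ratExt_ne_zero (right_ne_zero_of_mul hx)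
    exact hq ⟨δ + β, by rw [toRat_add, hβ, hδ, sub_add_cancel]⟩

/-- Convolutions are compatible with affine changes of the exponents. -/
theorem ratExt_conv_vecMul [Semiring F] [Fintype ν] {B : Matrix ν ν ℚ}
    (hB : Function.Bijective fun v => Matrix.vecMul v B) (a : ν → ℚ)
    {f g f' g' : K → (ν →₀ ℕ) → F}
    (hf : ∀ k q, ratExt (f' k) (Matrix.vecMul q B - a) = ratExt (f k) q)
    (hg : ∀ k q, ratExt (g' k) (Matrix.vecMul q B) = ratExt (g k) q) (q : ν → ℚ) :
    ratExt (conv f' g') (Matrix.vecMul q B - a) = ratExt (conv f g) q := by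
  rw [ratExt_conv, ratExt_conv]
  have hbij : Function.Bijective
      (fun x : K × (ν → ℚ) => (x.1, Matrix.vecMul x.2 B - a)) :=
    Function.bijective_id.prodMap ((Equiv.subRight a).bijective.comp hB)
  rw [← finsum_comp _ hbij]
  refine finsum_congr fun x => ?_
  dsimp only
  rw [hf, ← hg, sub_sub_sub_cancel_right, Matrix.sub_vecMul]

end RatExt

/-! ### Series that correspond under a monomial transformation -/

section Corresponds

variable {F : Type*} {κ ε : Type*}

/-- The coefficients of `f` at the exponents with `κ`-part `η`. -/
def slice [Semiring F] (f : MvPowerSeries (κ ⊕ ε) F) (η : κ →₀ ℕ) (β : ε →₀ ℕ) : F :=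
  MvPowerSeries.coeff (Finsupp.sumElim η β) f

theorem ratExt_coeff_sumElim [Semiring F] (f : MvPowerSeries (κ ⊕ ε) F) (η : κ →₀ ℕ) (q : ε → ℚ) :
    ratExt (fun α => MvPowerSeries.coeff α f) (Sum.elim (toRat η) q) = ratExt (slice f η) q := by
  by_cases hq : ∃ β, toRat β = q
  · obtain ⟨β, rfl⟩ := hq
    rw [ratExt_toRat, ← toRat_sumElim, ratExt_toRat, slice]
  · rw [ratExt_of_not_exists _ hq, ratExt_of_not_exists]
    rintro ⟨α, hα⟩
    refine hq ⟨(Finsupp.sumFinsuppEquivProdFinsupp α).2, funext fun e => ?_⟩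
    simpa [toRat] using congrFun hα (Sum.inr e)

/-- `f'(X) = X_ε ^ (-a) f(X_κ, X_ε ^ B)` as formal series: the term of `f` with exponents `(η, q)`
becomes the term of `f'` with exponents `(η, q B - a)`, and all terms of `f` and `f'` are matched in
this way. -/
def Corresponds [Semiring F] [Fintype ε] (B : Matrix ε ε ℚ) (a : ε → ℚ)
    (f f' : MvPowerSeries (κ ⊕ ε) F) : Prop :=
  ∀ η q, ratExt (slice f' η) (Matrix.vecMul q B - a) = ratExt (slice f η) q

theorem Corresponds.localize [NormedField F] [Fintype κ] [Fintype ε] {B : Matrix ε ε ℚ} {a : ε → ℚ}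
    {f f' : MvPowerSeries (κ ⊕ ε) F} (hf : Corresponds B a f f') (s : κ → F) :
    Corresponds B a (localize s f) (localize s f') := by
  have key : ∀ (f : MvPowerSeries (κ ⊕ ε) F) (η : κ →₀ ℕ) (q : ε → ℚ),
      ratExt (slice (LatentResolution.localize s f) η) q = ∑' η' : κ →₀ ℕ,
        ratExt (slice f η') q * ∏ i, ((η' i).choose (η i) : F) * s i ^ (η' i - η i) := by
    intro f η q
    by_cases hq : ∃ β, toRat β = q
    · obtain ⟨β, rfl⟩ := hq
      simp only [ratExt_toRat, slice]
      change ∑' η' : κ →₀ ℕ, _ = _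
      refine tsum_congr fun η' => ?_
      congr 1
      congr 2
      ext e
      cases e <;> simp
    · simp only [ratExt_of_not_exists _ hq, zero_mul, tsum_zero]
  intro η q
  rw [key, key]
  exact tsum_congr fun η' => by rw [hf]

theorem coeff_mul_eq_finsum [Semiring F] {ν : Type*} (f g : MvPowerSeries ν F) (n : ν →₀ ℕ) :
    MvPowerSeries.coeff n (f * g) = ∑ᶠ d : ν →₀ ℕ, MvPowerSeries.coeff d f *
      if d ≤ n then MvPowerSeries.coeff (n - d) g else 0 := by
  classical
  rw [MvPowerSeries.coeff_mul, finsum_eq_sum_of_support_subset (s := Finset.Iic n)]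
  · refine Finset.sum_nbij' (fun p => p.1) (fun d => (d, n - d)) ?_ ?_ ?_ ?_ ?_
    · intro p hp
      rw [Finset.HasAntidiagonal.mem_antidiagonal] at hp
      rw [Finset.mem_Iic, ← hp]
      exact self_le_add_right _ _
    · intro d hd
      rw [Finset.HasAntidiagonal.mem_antidiagonal]
      exact add_tsub_cancel_of_le (Finset.mem_Iic.1 hd)
    · intro p hp
      rw [Finset.HasAntidiagonal.mem_antidiagonal] at hp
      simp [← hp]
    · intro d _
      rfl
    · intro p hp
      rw [Finset.HasAntidiagonal.mem_antidiagonal] at hp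
      have h1 : p.1 ≤ n := by rw [← hp]; exact self_le_add_right _ _
      rw [if_pos h1, ← hp, add_tsub_cancel_left]
  · intro d hd
    rw [Finset.mem_coe, Finset.mem_Iic]
    by_contra h
    exact hd (by simp [h])

theorem sumElim_le_sumElim {η η' : κ →₀ ℕ} {β β' : ε →₀ ℕ} :
    Finsupp.sumElim η β ≤ Finsupp.sumElim η' β' ↔ η ≤ η' ∧ β ≤ β' := by
  constructor
  · intro h
    exact ⟨fun i => by simpa using h (Sum.inl i), fun i => by simpa using h (Sum.inr i)⟩
  · rintro ⟨h1, h2⟩ i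
    cases i
    · simpa using h1 _
    · simpa using h2 _

theorem sumElim_sub_sumElim (η η' : κ →₀ ℕ) (β β' : ε →₀ ℕ) :
    Finsupp.sumElim η β - Finsupp.sumElim η' β' = Finsupp.sumElim (η - η') (β - β') := by
  ext i
  cases i <;> simp

theorem finsum_sumElim {M : Type*} [AddCommMonoid M] (f : (κ ⊕ ε →₀ ℕ) → M) :
    ∑ᶠ d, f d = ∑ᶠ x : (κ →₀ ℕ) × (ε →₀ ℕ), f (Finsupp.sumElim x.1 x.2) :=
  (finsum_comp_equiv Finsupp.sumFinsuppEquivProdFinsupp.symm).symm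

open Classical in
theorem slice_mul [Semiring F] (f g : MvPowerSeries (κ ⊕ ε) F) (η : κ →₀ ℕ) :
    slice (f * g) η =
      conv (slice f) fun η' β => if η' ≤ η then slice g (η - η') β else 0 := by
  ext β
  rw [slice, coeff_mul_eq_finsum, finsum_sumElim, conv]
  refine finsum_congr fun x => ?_
  simp only [sumElim_le_sumElim, sumElim_sub_sumElim]
  by_cases h1 : x.1 ≤ η <;> by_cases h2 : x.2 ≤ β <;> simp [h1, h2, slice]

theorem Corresponds.mul [Semiring F] [Fintype ε] {B : Matrix ε ε ℚ}
    (hB : Function.Bijective fun v => Matrix.vecMul v B) {a : ε → ℚ}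
    {f f' g g' : MvPowerSeries (κ ⊕ ε) F} (hf : Corresponds B a f f') (hg : Corresponds B 0 g g') :
    Corresponds B a (f * g) (f' * g') := by
  classical
  intro η q
  rw [slice_mul, slice_mul]
  refine ratExt_conv_vecMul hB a hf (fun η' q => ?_) q
  by_cases h : η' ≤ η
  · simpa only [h, if_true, sub_zero] using hg (η - η') q
  · simp only [h, if_false, ratExt_zero]

theorem Corresponds.monomial_inl [Semiring F] [Fintype ε] {B : Matrix ε ε ℚ}
    (hB : Function.Bijective fun v => Matrix.vecMul v B) (η : κ →₀ ℕ) (c : F) :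
    Corresponds B 0 (MvPowerSeries.monomial (Finsupp.sumElim η (0 : ε →₀ ℕ)) c)
      (MvPowerSeries.monomial (Finsupp.sumElim η (0 : ε →₀ ℕ)) c) := by
  classical
  have key : ∀ (η' : κ →₀ ℕ) (q : ε → ℚ), ratExt (slice (MvPowerSeries.monomial
      (Finsupp.sumElim η (0 : ε →₀ ℕ)) c) η') q = if η' = η ∧ q = 0 then c else 0 := by
    intro η' q
    by_cases hq : ∃ β, toRat β = q
    · obtain ⟨β, rfl⟩ := hq
      rw [ratExt_toRat, slice, MvPowerSeries.coeff_monomial]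
      congr 1
      rw [eq_iff_iff]
      constructor
      · intro h
        refine ⟨Finsupp.ext fun i => ?_, funext fun i => ?_⟩
        · simpa using DFunLike.congr_fun h (Sum.inl i)
        · simpa [toRat] using DFunLike.congr_fun h (Sum.inr i)
      · rintro ⟨rfl, h⟩
        have : β = 0 := toRat_injective (by rw [h]; ext; simp [toRat])
        rw [this]
    · rw [ratExt_of_not_exists _ hq, if_neg]
      rintro ⟨-, rfl⟩
      exact hq ⟨0, by ext; simp [toRat]⟩
  intro η' q
  rw [key, key, sub_zero]
  congr 2
  rw [eq_iff_iff]
  constructor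
  · intro h
    exact hB.1 (by simpa using h)
  · rintro rfl
    exact Matrix.zero_vecMul _

theorem ratExt_slice_add [Semiring F] (f g : MvPowerSeries (κ ⊕ ε) F) (η : κ →₀ ℕ) (q : ε → ℚ) :
    ratExt (slice (f + g) η) q = ratExt (slice f η) q + ratExt (slice g η) q := by
  by_cases hq : ∃ β, toRat β = q
  · obtain ⟨β, rfl⟩ := hq
    simp [ratExt_toRat, slice]
  · simp [ratExt_of_not_exists _ hq]

theorem Corresponds.add [Semiring F] [Fintype ε] {B : Matrix ε ε ℚ} {a : ε → ℚ}
    {f f' g g' : MvPowerSeries (κ ⊕ ε) F} (hf : Corresponds B a f f') (hg : Corresponds B a g g') :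
    Corresponds B a (f + g) (f' + g') := by
  intro η q
  rw [ratExt_slice_add, ratExt_slice_add, hf, hg]

theorem Corresponds.zero [Semiring F] [Fintype ε] (B : Matrix ε ε ℚ) (a : ε → ℚ) :
    Corresponds B a (0 : MvPowerSeries (κ ⊕ ε) F) 0 := by
  have : ∀ η, slice (0 : MvPowerSeries (κ ⊕ ε) F) η = fun _ => 0 := by
    intro η; ext; simp [slice]
  intro η q
  rw [this, ratExt_zero, ratExt_zero]

theorem Corresponds.smul [Semiring F] [Fintype ε] {B : Matrix ε ε ℚ} {a : ε → ℚ}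
    {f f' : MvPowerSeries (κ ⊕ ε) F} (hf : Corresponds B a f f') (c : F) :
    Corresponds B a (c • f) (c • f') := by
  intro η q
  have key : ∀ f : MvPowerSeries (κ ⊕ ε) F, slice (c • f) η = fun β => c * slice f η β := by
    intro f; ext; simp [slice]
  rw [key, key, ratExt_map (c * ·) (mul_zero c), ratExt_map (c * ·) (mul_zero c), hf]

theorem Corresponds.sub [Ring F] [Fintype ε] {B : Matrix ε ε ℚ} {a : ε → ℚ}
    {f f' g g' : MvPowerSeries (κ ⊕ ε) F} (hf : Corresponds B a f f') (hg : Corresponds B a g g') :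
    Corresponds B a (f - g) (f' - g') := by
  have := hf.add (hg.smul (-1))
  simpa [sub_eq_add_neg] using this

theorem Corresponds.sum [Semiring F] [Fintype ε] {B : Matrix ε ε ℚ} {a : ε → ℚ} {ι : Type*}
    {f f' : ι → MvPowerSeries (κ ⊕ ε) F} (s : Finset ι) (h : ∀ i ∈ s, Corresponds B a (f i) (f' i)) :
    Corresponds B a (∑ i ∈ s, f i) (∑ i ∈ s, f' i) := by
  classical
  induction s using Finset.induction_on with
  | empty => simpa using Corresponds.zero B a
  | insert i s hi ih =>
    rw [Finset.sum_insert hi, Finset.sum_insert hi]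
    exact (h i (Finset.mem_insert_self _ _)).add
      (ih fun j hj => h j (Finset.mem_insert_of_mem hj))

theorem Corresponds.one [Semiring F] [Fintype ε] {B : Matrix ε ε ℚ}
    (hB : Function.Bijective fun v => Matrix.vecMul v B) :
    Corresponds B 0 (1 : MvPowerSeries (κ ⊕ ε) F) 1 := by
  have := Corresponds.monomial_inl (κ := κ) hB 0 (1 : F)
  have h0 : Finsupp.sumElim (0 : κ →₀ ℕ) (0 : ε →₀ ℕ) = 0 := by ext i; cases i <;> simp
  rwa [h0, MvPowerSeries.monomial_zero_one] at this

theorem Corresponds.X_inl [Semiring F] [Fintype ε] {B : Matrix ε ε ℚ}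
    (hB : Function.Bijective fun v => Matrix.vecMul v B) (i : κ) :
    Corresponds B 0 (MvPowerSeries.X (Sum.inl i) : MvPowerSeries (κ ⊕ ε) F)
      (MvPowerSeries.X (Sum.inl i)) := by
  classical
  have := Corresponds.monomial_inl (κ := κ) hB (Finsupp.single i 1) (1 : F)
  have h0 : Finsupp.sumElim (Finsupp.single i 1) (0 : ε →₀ ℕ) = Finsupp.single (Sum.inl i) 1 := by
    ext j; cases j <;> simp [Finsupp.single_apply]
  rwa [h0] at this

theorem Corresponds.pow [CommSemiring F] [Fintype ε] {B : Matrix ε ε ℚ}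
    (hB : Function.Bijective fun v => Matrix.vecMul v B)
    {f f' : MvPowerSeries (κ ⊕ ε) F} (hf : Corresponds B 0 f f') (n : ℕ) :
    Corresponds B 0 (f ^ n) (f' ^ n) := by
  induction n with
  | zero => simpa using Corresponds.one hB
  | succ n ih => rw [pow_succ, pow_succ]; exact ih.mul hB hf

theorem Corresponds.prod [CommSemiring F] [Fintype ε] {B : Matrix ε ε ℚ}
    (hB : Function.Bijective fun v => Matrix.vecMul v B) {ι : Type*}
    {f f' : ι → MvPowerSeries (κ ⊕ ε) F} (s : Finset ι) (h : ∀ i ∈ s, Corresponds B 0 (f i) (f' i)) :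
    Corresponds B 0 (∏ i ∈ s, f i) (∏ i ∈ s, f' i) := by
  classical
  induction s using Finset.induction_on with
  | empty => simpa using Corresponds.one hB
  | insert i s hi ih =>
    rw [Finset.prod_insert hi, Finset.prod_insert hi]
    exact (h i (Finset.mem_insert_self _ _)).mul hB
      (ih fun j hj => h j (Finset.mem_insert_of_mem hj))

theorem prod_X_pow_eq_monomial [CommSemiring F] {ν : Type*} [Fintype ν] (n : ν →₀ ℕ) :
    ∏ i, (MvPowerSeries.X i : MvPowerSeries ν F) ^ n i = MvPowerSeries.monomial n 1 := by
  have := MvPowerSeries.monomial_eq (R := F) n (fun _ => 1)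
  simp only [one_pow, one_smul] at this
  rw [Finsupp.prod_fintype _ _ (fun _ => pow_zero _)] at this
  rw [← this]
  simp [Finsupp.prod]

open Classical in
theorem slice_subst [Field F] [Fintype κ] [Fintype ε] (L : κ → MvPowerSeries (κ ⊕ ε) F)
    (hL : ∀ i, MvPowerSeries.constantCoeff (L i) = 0) (f : MvPowerSeries (κ ⊕ ε) F)
    (η : κ →₀ ℕ) :
    slice (MvPowerSeries.subst (Sum.elim L fun e => MvPowerSeries.X (Sum.inr e)) f) η =
      conv (slice f) fun η' β => slice (∏ i, L i ^ η' i) η β := by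
  have hs : MvPowerSeries.HasSubst
      (Sum.elim L fun e => (MvPowerSeries.X (Sum.inr e) : MvPowerSeries (κ ⊕ ε) F)) := by
    apply MvPowerSeries.hasSubst_of_constantCoeff_zero
    rintro (i | e)
    · exact hL i
    · simp
  ext β
  rw [slice, MvPowerSeries.coeff_subst hs, finsum_sumElim, conv]
  refine finsum_congr fun x => ?_
  rw [smul_eq_mul, Finsupp.prod_fintype _ _ (fun _ => pow_zero _), Fintype.prod_sum_type]
  have h1 : ∏ e, (MvPowerSeries.X (Sum.inr e) : MvPowerSeries (κ ⊕ ε) F) ^ x.2 e =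
      MvPowerSeries.monomial (Finsupp.sumElim 0 x.2) 1 := by
    rw [← prod_X_pow_eq_monomial, Fintype.prod_sum_type]
    simp
  simp only [Sum.elim_inl, Sum.elim_inr, Finsupp.sumElim_inl, Finsupp.sumElim_inr]
  rw [h1, MvPowerSeries.coeff_mul_monomial]
  simp [sumElim_le_sumElim, sumElim_sub_sumElim, slice]

/-- Linear changes and completions of perfect powers preserve the correspondence, because the
substituted series correspond without a shift. -/
theorem Corresponds.reduce [NormedField F] [Fintype κ] [DecidableEq κ] [Fintype ε]
    {B : Matrix ε ε ℚ} (hB : Function.Bijective fun v => Matrix.vecMul v B) {a : ε → ℚ}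
    {f f' h h' : MvPowerSeries (κ ⊕ ε) F} (hf : Corresponds B a f f') (hh : Corresponds B 0 h h')
    (h0 : MvPowerSeries.constantCoeff h = 0) (h0' : MvPowerSeries.constantCoeff h' = 0)
    (i₁ : κ) (g : Matrix κ κ F) :
    Corresponds B a (reduce i₁ g h f) (reduce i₁ g h' f') := by
  classical
  have hc : ∀ h : MvPowerSeries (κ ⊕ ε) F, MvPowerSeries.constantCoeff h = 0 → ∀ i : κ,
      MvPowerSeries.constantCoeff
        (∑ j, g i j • (MvPowerSeries.X (Sum.inl j) - if j = i₁ then h else 0)) = 0 := by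
    intro h h0 i
    rw [map_sum]
    refine Finset.sum_eq_zero fun j _ => ?_
    rw [MvPowerSeries.constantCoeff_smul]
    split_ifs <;> simp [h0]
  intro η q
  rw [LatentResolution.reduce, LatentResolution.reduce, slice_subst _ (hc h' h0'),
    slice_subst _ (hc h h0)]
  refine ratExt_conv_vecMul hB a hf (fun η' q => ?_) q
  have := Corresponds.prod hB Finset.univ (f := fun i => (∑ j, g i j •
    ((MvPowerSeries.X (Sum.inl j) : MvPowerSeries (κ ⊕ ε) F) - if j = i₁ then h else 0)) ^ η' i)
    (f' := fun i => (∑ j, g i j •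
    ((MvPowerSeries.X (Sum.inl j) : MvPowerSeries (κ ⊕ ε) F) - if j = i₁ then h' else 0)) ^ η' i)
    (fun i _ => ?_) η q
  · simpa only [sub_zero] using this
  · refine Corresponds.pow hB (Corresponds.sum _ fun j _ => Corresponds.smul ?_ _) _
    refine (Corresponds.X_inl hB j).sub ?_
    split_ifs
    · exact hh
    · exact Corresponds.zero B 0

end Corresponds

/-! ### Monomial transformations -/

section PartialTransform

variable {F : Type*} [NormedField F] {ν σ τ : Type*} [Fintype ν]

theorem IsExponentialMatrix.sum_le_sum [DecidableEq ν] {f : MvPowerSeries ν F} {A : ν →₀ ℕ}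
    {M : Matrix ν σ ℕ} (h : IsExponentialMatrix f A M) {α : ν →₀ ℕ}
    (hα : MvPowerSeries.coeff α f ≠ 0) (j : σ) : ∑ i, A i * M i j ≤ ∑ i, α i * M i j := by
  have hmem : toReal α ∈ newtonPolyhedron f :=
    ⟨toReal α, subset_convexHull ℝ _ ⟨α, hα, rfl⟩, 0, le_refl (0 : ν → ℝ), add_zero _⟩
  have := (h.mem_face j).2 _ hmem
  simp only [dotProduct, toReal] at this
  have h2 : ((∑ i, M i j * A i : ℕ) : ℝ) ≤ ((∑ i, M i j * α i : ℕ) : ℝ) := by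
    push_cast
    exact this
  simpa only [mul_comm] using (Nat.cast_le (α := ℝ)).1 h2

theorem finsum_cond_eq_of_unique {α M : Type*} [AddCommMonoid M] {p : α → Prop} (f : α → M)
    {a : α} (ha : p a) (h : ∀ b, p b → b = a) : ∑ᶠ (b : α) (_ : p b), f b = f a := by
  classical
  rw [finsum_eq_single _ a]
  · rw [finsum_eq_if (p := p a), if_pos ha]
  · intro b hb
    rw [finsum_eq_if (p := p b), if_neg fun hp => hb (h b hp)]

theorem finsum_cond_eq_zero {α M : Type*} [AddCommMonoid M] {p : α → Prop} (f : α → M)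
    (h : ∀ b, ¬p b) : ∑ᶠ (b : α) (_ : p b), f b = 0 := by
  simp [h]

/-- Coefficients of a partial transform, for an injective exponent matrix for which no term is lost. -/
theorem ratExt_partialTransform {N : Matrix ν (σ ⊕ τ) ℚ}
    (hN : Function.Injective fun v => Matrix.vecMul v N) {a : τ → ℚ} {w : MvPowerSeries ν F}
    (hw : ∀ α, MvPowerSeries.coeff α w ≠ 0 →
      ∃ γ : σ ⊕ τ →₀ ℕ, Matrix.vecMul (toRat α) N = toRat γ + Sum.elim (0 : σ → ℚ) a)
    (b : ν → ℚ) :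
    ratExt (fun γ => MvPowerSeries.coeff γ (partialTransform N a w))
      (Matrix.vecMul b N - Sum.elim (0 : σ → ℚ) a) =
      ratExt (fun α => MvPowerSeries.coeff α w) b := by
  by_cases hq : ∃ γ, toRat γ = Matrix.vecMul b N - Sum.elim (0 : σ → ℚ) a
  · obtain ⟨γ, hγ⟩ := hq
    rw [← hγ, ratExt_toRat]
    have hγ' : Matrix.vecMul b N = toRat γ + Sum.elim (0 : σ → ℚ) a := by rw [hγ, sub_add_cancel]
    change ∑ᶠ (α : ν →₀ ℕ) (_ : Matrix.vecMul (toRat α) N = toRat γ + Sum.elim (0 : σ → ℚ) a),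
      MvPowerSeries.coeff α w = _
    rw [← hγ']
    by_cases hb : ∃ α, toRat α = b
    · obtain ⟨α, rfl⟩ := hb
      rw [ratExt_toRat, finsum_cond_eq_of_unique
        (p := fun β => Matrix.vecMul (toRat β) N = Matrix.vecMul (toRat α) N)
        (fun α => MvPowerSeries.coeff α w) rfl]
      exact fun β hβ => toRat_injective (hN hβ)
    · rw [ratExt_of_not_exists _ hb]
      exact finsum_cond_eq_zero _ fun α h => hb ⟨α, hN h⟩
  · rw [ratExt_of_not_exists _ hq]
    by_contra h
    obtain ⟨α, rfl, hα⟩ := exists_of_ratExt_ne_zero (Ne.symm h)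
    obtain ⟨γ, hγ⟩ := hw α (by rw [hα]; exact Ne.symm h)
    exact hq ⟨γ, by rw [hγ, add_sub_cancel_right]⟩

end PartialTransform

section CanonicalReduction

variable {ν σ τ : Type*}

theorem vecMul_canonicalReduction_inl [Fintype ν] [DecidableEq σ] [DecidableEq τ]
    (e : ν ≃ σ ⊕ τ) (M : Matrix ν (σ ⊕ τ) ℚ) (b : ν → ℚ) (j : σ) :
    Matrix.vecMul b (canonicalReduction e M) (Sum.inl j) = b (e.symm (Sum.inl j)) := by
  classical
  simp only [Matrix.vecMul, dotProduct, canonicalReduction, Matrix.of_apply, Sum.elim_inl,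
    mul_ite, mul_one, mul_zero]
  simp [← Equiv.eq_symm_apply]

theorem vecMul_canonicalReduction_inr [Fintype ν] [DecidableEq σ] [DecidableEq τ]
    (e : ν ≃ σ ⊕ τ) (M : Matrix ν (σ ⊕ τ) ℚ) (b : ν → ℚ) (j : τ) :
    Matrix.vecMul b (canonicalReduction e M) (Sum.inr j) = Matrix.vecMul b M (Sum.inr j) :=
  rfl

theorem vecMul_canonicalReduction_injective [Fintype ν] [Fintype σ] [DecidableEq σ] [Fintype τ]
    [DecidableEq τ] (e : ν ≃ σ ⊕ τ) (M : Matrix ν (σ ⊕ τ) ℚ)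
    (h : (excSubmatrix e M).det ≠ 0) :
    Function.Injective fun v => Matrix.vecMul v (canonicalReduction e M) := by
  intro v v' hv
  rw [← sub_eq_zero]
  have hb : Matrix.vecMul (v - v') (canonicalReduction e M) = 0 := by
    rw [Matrix.sub_vecMul]
    exact sub_eq_zero.2 hv
  generalize v - v' = b at hb
  have h1 : ∀ j, b (e.symm (Sum.inl j)) = 0 := fun j => by
    rw [← vecMul_canonicalReduction_inl e M b j, hb, Pi.zero_apply]
  have h2 : (fun j => b (e.symm (Sum.inr j))) = 0 := by
    by_contra hne
    refine h (Matrix.exists_vecMul_eq_zero_iff.1 ⟨_, hne, funext fun j => ?_⟩)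
    have := congrFun hb (Sum.inr j)
    rw [vecMul_canonicalReduction_inr, Pi.zero_apply, Matrix.vecMul, dotProduct,
      ← e.symm.sum_comp, Fintype.sum_sum_type] at this
    simpa [h1, Matrix.vecMul, dotProduct, excSubmatrix] using this
  ext i
  obtain ⟨x, rfl⟩ := e.symm.surjective i
  cases x with
  | inl j => exact h1 j
  | inr j => exact congrFun h2 j

theorem exists_kernel_of_not_isConsistent [Fintype τ] {M : Matrix ν (σ ⊕ τ) ℚ} {x : ν}
    (h : ¬IsConsistent M x) :
    ∃ u : τ → ℚ, u ≠ 0 ∧ ∀ i, i ≠ x → ∑ j, M i (Sum.inr j) * u j = 0 := by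
  by_contra! hcon
  apply h
  rw [IsConsistent, Matrix.rank, LinearMap.finrank_range_of_inj, Module.finrank_fintype_fun_eq_card]
  rw [← LinearMap.ker_eq_bot, LinearMap.ker_eq_bot']
  intro u hu
  by_contra hne
  obtain ⟨i, hi, hs⟩ := hcon u hne
  exact hs (congrFun hu ⟨i, hi⟩)

end CanonicalReduction

/-! ### The latent correspondence of the first step -/

section FirstStepCorrespondence

variable {F : Type*} [NormedField F] {κ ι : Type*}
  [Fintype κ] [DecidableEq κ] [Fintype ι] [DecidableEq ι]
  {M : Matrix (κ ⊕ Option ι) (κ ⊕ Option ι) ℕ}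

/-- The exceptional block of `T̂`, with the rows `[l E]` and `N_1`. -/
noncomputable def interimB (M : Matrix (κ ⊕ Option ι) (κ ⊕ Option ι) ℕ) : Matrix (Option ι) (Option ι) ℚ :=
  Matrix.of fun i j => match i, j with
    | some e, none => vecL M e
    | some e, some e' => if e = e' then 1 else 0
    | none, j => primaryRow M j

theorem interimT_eq_fromBlocks : interimT M = Matrix.fromBlocks 1 0 0 (interimB M) := rfl

theorem vecMul_interimT (b : κ ⊕ Option ι → ℚ) :
    Matrix.vecMul b (interimT M) =
      Sum.elim (b ∘ Sum.inl) (Matrix.vecMul (b ∘ Sum.inr) (interimB M)) := by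
  rw [interimT_eq_fromBlocks, Matrix.vecMul_fromBlocks]
  simp

theorem vecMul_interimB_none (q : Option ι → ℚ) :
    Matrix.vecMul q (interimB M) none =
      q none * primaryRow M none + ∑ e, q (some e) * vecL M e := by
  simp [Matrix.vecMul, dotProduct, Fintype.sum_option, interimB]

theorem vecMul_interimB_some (q : Option ι → ℚ) (e : ι) :
    Matrix.vecMul q (interimB M) (some e) = q none * primaryRow M (some e) + q (some e) := by
  simp [Matrix.vecMul, dotProduct, Fintype.sum_option, interimB]

/-- The pairing of `N_1` with `(-1, l)`, the denominator of the latent component. -/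
noncomputable def latentDenominator (M : Matrix (κ ⊕ Option ι) (κ ⊕ Option ι) ℕ) : ℚ :=
  -primaryRow M none + ∑ e, primaryRow M (some e) * vecL M e

theorem blockD_mulVec_vecL (h : (blockD M).det ≠ 0) (e : ι) :
    ∑ e', (M (Sum.inr (some e)) (Sum.inr (some e')) : ℚ) * vecL M e' =
      M (Sum.inr (some e)) (Sum.inr none) := by
  have : Matrix.mulVec (blockD M) (vecL M) =
      fun e => (M (Sum.inr (some e)) (Sum.inr none) : ℚ) := by
    rw [vecL, Matrix.mulVec_mulVec, Matrix.mul_nonsing_inv _ (isUnit_iff_ne_zero.2 h),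
      Matrix.one_mulVec]
  exact congrFun this e

theorem latentDenominator_ne_zero (hD : (blockD M).det ≠ 0)
    (hE : (excSubmatrix (Equiv.refl _) (ratMatrix M)).det ≠ 0) : latentDenominator M ≠ 0 := by
  intro h0
  refine hE (Matrix.exists_mulVec_eq_zero_iff.1
    ⟨fun j => j.elim (-1) (vecL M), fun h => ?_, funext fun i => ?_⟩)
  · simpa using congrFun h none
  · simp only [Matrix.mulVec, dotProduct, Fintype.sum_option, excSubmatrix, ratMatrix,
      Matrix.submatrix_apply, Matrix.map_apply, Equiv.refl_symm, Equiv.refl_apply,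
      Option.elim_none, Option.elim_some, Pi.zero_apply]
    cases i with
    | none =>
      rw [latentDenominator] at h0
      simpa [primaryRow] using h0
    | some e => rw [blockD_mulVec_vecL hD]; ring

theorem vecMul_interimB_pairing (q : Option ι → ℚ) :
    -Matrix.vecMul q (interimB M) none + ∑ e, Matrix.vecMul q (interimB M) (some e) * vecL M e =
      q none * latentDenominator M := by
  simp only [vecMul_interimB_none, vecMul_interimB_some, latentDenominator, add_mul,
    Finset.sum_add_distrib, mul_add, Finset.mul_sum, mul_assoc]
  ring

theorem vecMul_interimB_bijective (h : latentDenominator M ≠ 0) :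
    Function.Bijective fun v => Matrix.vecMul v (interimB M) := by
  have hinj : Function.Injective fun v => Matrix.vecMul v (interimB M) := by
    intro v v' hv
    rw [← sub_eq_zero]
    have hb : Matrix.vecMul (v - v') (interimB M) = 0 := by
      rw [Matrix.sub_vecMul]
      exact sub_eq_zero.2 hv
    generalize v - v' = b at hb
    have h0 : b none = 0 := by
      have := vecMul_interimB_pairing (M := M) b
      rw [hb] at this
      simpa [h] using this.symm
    ext i
    cases i with
    | none => exact h0
    | some e =>
      have := congrFun hb (some e)
      rw [vecMul_interimB_some, h0] at this
      simpa using this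
  exact ⟨hinj, Matrix.vecMul_surjective_iff_isUnit.2 (Matrix.vecMul_injective_iff_isUnit.1 hinj)⟩

theorem vecMul_interimT_bijective (h : latentDenominator M ≠ 0) :
    Function.Bijective fun v => Matrix.vecMul v (interimT M) := by
  have hinj : Function.Injective fun v => Matrix.vecMul v (interimT M) := by
    intro v v' hv
    simp only [vecMul_interimT] at hv
    ext i
    cases i with
    | inl i => exact congrFun hv (Sum.inl i)
    | inr e =>
      have : v ∘ Sum.inr = v' ∘ Sum.inr :=
        (vecMul_interimB_bijective h).1 (funext fun j => congrFun hv (Sum.inr j))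
      exact congrFun this e
  exact ⟨hinj, Matrix.vecMul_surjective_iff_isUnit.2 (Matrix.vecMul_injective_iff_isUnit.1 hinj)⟩

theorem latentComponent_eq_of_vecMul (h : latentDenominator M ≠ 0) {α : κ ⊕ Option ι →₀ ℕ}
    {b c : κ ⊕ Option ι → ℚ}
    (hα : toRat α = Matrix.vecMul b (interimT M) + c) :
    latentComponent M α = b (Sum.inr none) +
      (-c (Sum.inr none) + ∑ e, c (Sum.inr (some e)) * vecL M e) / latentDenominator M := by
  have h1 : ∀ j, (α (Sum.inr j) : ℚ) =
      Matrix.vecMul (b ∘ Sum.inr) (interimB M) j + c (Sum.inr j) := by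
    intro j
    have := congrFun hα (Sum.inr j)
    rwa [vecMul_interimT] at this
  change (-(α (Sum.inr none) : ℚ) + ∑ e, (α (Sum.inr (some e)) : ℚ) * vecL M e) /
    latentDenominator M = _
  have h2 := vecMul_interimB_pairing (M := M) (b ∘ Sum.inr)
  have h3 : b (Sum.inr none) = (b (Sum.inr none) * latentDenominator M) / latentDenominator M :=
    (mul_div_cancel_right₀ _ h).symm
  rw [h3, ← add_div]
  congr 1
  rw [Function.comp_apply] at h2
  rw [← h2]
  simp only [h1, add_mul, Finset.sum_add_distrib]
  ring

/-- An exponent of latent component zero is `β T̂` for the natural exponent `β` that agrees with it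
except for a zero at `x_1`. -/
theorem toRat_eq_vecMul_of_latentComponent_eq_zero (h : latentDenominator M ≠ 0)
    {α : κ ⊕ Option ι →₀ ℕ} (hα : latentComponent M α = 0) :
    toRat α = Matrix.vecMul (toRat (α.erase (Sum.inr none))) (interimT M) := by
  obtain ⟨b, hb⟩ := (vecMul_interimT_bijective h).2 (toRat α)
  dsimp only at hb
  have h0 : b (Sum.inr none) = 0 := by
    have := latentComponent_eq_of_vecMul h (α := α) (b := b) (c := 0) (by rw [hb, add_zero])
    rw [hα] at this
    simpa using this.symm
  rw [← hb]
  congr 1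
  rw [vecMul_interimT] at hb
  ext i
  match i with
  | Sum.inl i => simpa [toRat] using congrFun hb (Sum.inl i)
  | Sum.inr none => simp [toRat, h0]
  | Sum.inr (some e) =>
    have := congrFun hb (Sum.inr (some e))
    rw [Sum.elim_inr, vecMul_interimB_some] at this
    simpa [toRat, h0] using this

theorem IsInconsistentStep.denominator_ne_zero {w : MvPowerSeries (κ ⊕ Option ι) F} {d : ℕ}
    {A : κ ⊕ Option ι →₀ ℕ} (hM : IsInconsistentStep w d A M) : latentDenominator M ≠ 0 :=
  latentDenominator_ne_zero hM.det_D hM.det_exc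

/-- Inconsistency: in every row but that of `x_1`, column `k + 1` is the combination of the remaining
exceptional columns with coefficients `l`. -/
theorem sum_mul_vecL_of_not_isConsistent (hD : (blockD M).det ≠ 0)
    (h : ¬IsConsistent (ratMatrix M) (Sum.inr none)) {i : κ ⊕ Option ι} (hi : i ≠ Sum.inr none) :
    ∑ e, (M i (Sum.inr (some e)) : ℚ) * vecL M e = M i (Sum.inr none) := by
  obtain ⟨u, hu, hker⟩ := exists_kernel_of_not_isConsistent h
  simp only [ratMatrix, Matrix.map_apply, Fintype.sum_option] at hker
  have hsome : ∀ e, u (some e) = -u none * vecL M e := by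
    have hz : Matrix.mulVec (blockD M) (fun e => u (some e) + u none * vecL M e) = 0 := by
      ext e
      have h1 := hker (Sum.inr (some e)) (by simp)
      have h2 := blockD_mulVec_vecL hD e
      simp only [Matrix.mulVec, dotProduct, blockD, ratMatrix, Matrix.submatrix_apply,
        Matrix.map_apply, mul_add, Finset.sum_add_distrib, Pi.zero_apply]
      have h3 : ∑ e', (M (Sum.inr (some e)) (Sum.inr (some e')) : ℚ) * (u none * vecL M e') =
          u none * M (Sum.inr (some e)) (Sum.inr none) := by
        rw [← h2, Finset.mul_sum]
        exact Finset.sum_congr rfl fun _ _ => by ring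
      rw [h3]
      linarith
    intro e
    have := congrFun (Matrix.eq_zero_of_mulVec_eq_zero hD hz) e
    simp only [Pi.zero_apply] at this
    linarith
  have hnone : u none ≠ 0 := by
    intro h0
    apply hu
    ext j
    cases j with
    | none => exact h0
    | some e => rw [hsome, h0]; simp
  have h1 := hker i hi
  simp only [hsome] at h1
  have h3 : ∑ e, (M i (Sum.inr (some e)) : ℚ) * (-u none * vecL M e) =
      -u none * ∑ e, (M i (Sum.inr (some e)) : ℚ) * vecL M e := by
    rw [Finset.mul_sum]
    exact Finset.sum_congr rfl fun _ _ => by ring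
  rw [h3] at h1
  have : u none * ((M i (Sum.inr none) : ℚ) - ∑ e, (M i (Sum.inr (some e)) : ℚ) * vecL M e) = 0 := by
    linarith
  linarith [(mul_eq_zero.1 this).resolve_left hnone]

/-- The factorization `N = S T̂`. -/
theorem reducedMatrix_eq_mul (hD : (blockD M).det ≠ 0)
    (h : ¬IsConsistent (ratMatrix M) (Sum.inr none)) :
    reducedMatrix M = interimS M * interimT M := by
  ext i j
  rw [Matrix.mul_apply, Fintype.sum_sum_type, interimT_eq_fromBlocks]
  cases j with
  | inl j =>
    by_cases hi : i = Sum.inl j <;>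
      simp [reducedMatrix, canonicalReduction, interimS, Matrix.one_apply, hi]
  | inr j =>
    simp only [Matrix.fromBlocks_apply₁₂, Matrix.fromBlocks_apply₂₂, Matrix.zero_apply, mul_zero,
      Finset.sum_const_zero, zero_add, Fintype.sum_option]
    by_cases hi : i = Sum.inr none
    · subst hi
      simp [reducedMatrix, canonicalReduction, interimS, interimB, ratMatrix, primaryRow]
    · cases j with
      | none =>
        have := sum_mul_vecL_of_not_isConsistent hD h hi
        simp [reducedMatrix, canonicalReduction, interimS, interimB, ratMatrix, hi, this]
      | some e =>
        simp [reducedMatrix, canonicalReduction, interimS, interimB, ratMatrix, hi]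

/-- The partial transform `q` and the total transform of `w` under `S` correspond under `T̂`. -/
theorem IsInconsistentStep.corresponds_firstTransform {w : MvPowerSeries (κ ⊕ Option ι) F} {d : ℕ}
    {A : κ ⊕ Option ι →₀ ℕ} (hM : IsInconsistentStep w d A M) :
    Corresponds (interimB M) (excFactor M A) (partialTransform (interimS M) 0 w)
      (firstTransform w A M) := by
  have hfac := reducedMatrix_eq_mul hM.det_D hM.inconsistent
  have hNinj : Function.Injective fun v => Matrix.vecMul v (reducedMatrix M) :=
    vecMul_canonicalReduction_injective _ _ hM.det_exc
  have hSinj : Function.Injective fun v => Matrix.vecMul v (interimS M) := by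
    intro v v' hv
    apply hNinj
    simp only at hv ⊢
    rw [hfac, ← Matrix.vecMul_vecMul, ← Matrix.vecMul_vecMul, hv]
  have hSsurj : Function.Surjective fun v => Matrix.vecMul v (interimS M) :=
    Matrix.vecMul_surjective_iff_isUnit.2 (Matrix.vecMul_injective_iff_isUnit.1 hSinj)
  have hS : ∀ α, MvPowerSeries.coeff α w ≠ 0 → ∃ γ : κ ⊕ Option ι →₀ ℕ,
      Matrix.vecMul (toRat α) (interimS M) =
        toRat γ + Sum.elim (0 : κ → ℚ) (0 : Option ι → ℚ) := by
    intro α _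
    obtain ⟨γ, hγ⟩ := exists_toRat_eq (q := Matrix.vecMul (toRat α) (interimS M)) fun j => by
      have hent : ∀ i, ∃ n : ℕ, (n : ℚ) = interimS M i j := by
        intro i
        match j with
        | Sum.inl j => exact ⟨if i = Sum.inl j then 1 else 0, by simp [interimS]⟩
        | Sum.inr (some e) =>
          exact ⟨if i = Sum.inr none then 0 else M i (Sum.inr (some e)), by simp [interimS]⟩
        | Sum.inr none => exact ⟨if i = Sum.inr none then 1 else 0, by simp [interimS]⟩
      choose n hn using hent
      exact ⟨∑ i, α i * n i, by simp [Matrix.vecMul, dotProduct, toRat, hn]⟩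
    refine ⟨γ, ?_⟩
    rw [hγ]
    ext i
    cases i <;> simp
  have hN : ∀ α, MvPowerSeries.coeff α w ≠ 0 → ∃ γ : κ ⊕ Option ι →₀ ℕ,
      Matrix.vecMul (toRat α) (reducedMatrix M) =
        toRat γ + Sum.elim (0 : κ → ℚ) (excFactor M A) := by
    intro α hα
    obtain ⟨γ, hγ⟩ := exists_toRat_eq (q := Matrix.vecMul (toRat α) (reducedMatrix M) -
        Sum.elim (0 : κ → ℚ) (excFactor M A)) fun j => by
      cases j with
      | inl j =>
        refine ⟨α (Sum.inl j), ?_⟩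
        rw [Pi.sub_apply, reducedMatrix, vecMul_canonicalReduction_inl]
        simp [toRat]
      | inr j =>
        refine ⟨∑ i, α i * M i (Sum.inr j) - ∑ i, A i * M i (Sum.inr j), ?_⟩
        rw [Nat.cast_sub (hM.exponential.sum_le_sum hα _)]
        simp only [excFactor, reducedMatrix, Matrix.vecMul, dotProduct, toRat, ratMatrix,
          Pi.sub_apply, Sum.elim_inr]
        push_cast
        rfl
    exact ⟨γ, by rw [hγ, sub_add_cancel]⟩
  intro η q
  obtain ⟨b, hb⟩ := hSsurj (Sum.elim (toRat η) q)
  dsimp only at hb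
  have h1 := ratExt_partialTransform hSinj hS b
  have h2 := ratExt_partialTransform hNinj hN b
  rw [hfac, ← Matrix.vecMul_vecMul, hb, vecMul_interimT] at h2
  rw [hb] at h1
  have e1 : Sum.elim (toRat η) q - Sum.elim (0 : κ → ℚ) (0 : Option ι → ℚ) =
      Sum.elim (toRat η) q := by
    ext i; cases i <;> simp
  have e2 : Sum.elim (Sum.elim (toRat η) q ∘ Sum.inl)
      (Matrix.vecMul (Sum.elim (toRat η) q ∘ Sum.inr) (interimB M)) -
        Sum.elim (0 : κ → ℚ) (excFactor M A) =
      Sum.elim (toRat η) (Matrix.vecMul q (interimB M) - excFactor M A) := by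
    ext i; cases i <;> simp
  rw [e1, ratExt_coeff_sumElim] at h1
  rw [e2, ← hfac, ratExt_coeff_sumElim] at h2
  exact h2.trans h1.symm

theorem toSynthetic_corresponds (hden : latentDenominator M ≠ 0)
    {h : MvPowerSeries (κ ⊕ Option ι) F} (hh : LatentZero M h) :
    Corresponds (interimB M) 0 (toSynthetic M h) h := by
  intro η q
  rw [sub_zero]
  by_cases hq : ∃ β, toRat β = q
  · obtain ⟨β, rfl⟩ := hq
    rw [ratExt_toRat]
    change _ = ∑ᶠ (α' : (κ ⊕ Option ι) →₀ ℕ)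
      (_ : Matrix.vecMul (toRat (Finsupp.sumElim η β)) (interimT M) = toRat α'),
        MvPowerSeries.coeff α' h
    have e : Matrix.vecMul (toRat (Finsupp.sumElim η β)) (interimT M) =
        Sum.elim (toRat η) (Matrix.vecMul (toRat β) (interimB M)) := by
      rw [vecMul_interimT, toRat_sumElim, Sum.elim_comp_inl, Sum.elim_comp_inr]
    rw [e, ← ratExt_coeff_sumElim]
    by_cases hγ : ∃ γ, toRat γ = Sum.elim (toRat η) (Matrix.vecMul (toRat β) (interimB M))
    · obtain ⟨γ, hγ⟩ := hγ
      rw [← hγ, ratExt_toRat, finsum_cond_eq_of_unique (p := fun α' => toRat γ = toRat α')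
        (fun α' => MvPowerSeries.coeff α' h) rfl]
      exact fun b hb => (toRat_injective hb).symm
    · rw [ratExt_of_not_exists _ hγ]
      symm
      exact finsum_cond_eq_zero _ fun α h => hγ ⟨α, h.symm⟩
  · rw [ratExt_of_not_exists _ hq]
    by_contra hne
    obtain ⟨γ, hγ, hc⟩ := exists_of_ratExt_ne_zero hne
    have hlat := hh (Finsupp.sumElim η γ) (by
      change slice h η γ ≠ 0
      rw [hc]; exact hne)
    have h1 := toRat_eq_vecMul_of_latentComponent_eq_zero hden hlat
    rw [toRat_sumElim, hγ, vecMul_interimT] at h1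
    have h2 := (vecMul_interimB_bijective hden).1 (funext fun j => congrFun h1 (Sum.inr j))
    refine hq ⟨(Finsupp.sumFinsuppEquivProdFinsupp
      ((Finsupp.sumElim η γ).erase (Sum.inr none))).2, ?_⟩
    rw [h2]
    ext j
    simp [toRat]

theorem constantCoeff_eq_ratExt (f : MvPowerSeries (κ ⊕ Option ι) F) :
    MvPowerSeries.constantCoeff f = ratExt (slice f 0) 0 := by
  have h0 : (0 : Option ι → ℚ) = toRat 0 := by ext; simp [toRat]
  have h1 : Finsupp.sumElim (0 : κ →₀ ℕ) (0 : Option ι →₀ ℕ) = 0 := by ext i; cases i <;> simp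
  rw [h0, ratExt_toRat, slice, h1, MvPowerSeries.coeff_zero_eq_constantCoeff_apply]

/-- The interim transform and the latent apex form correspond under `T̂`. -/
theorem interimTransform_corresponds {w : MvPowerSeries (κ ⊕ Option ι) F} {d : ℕ}
    {A : κ ⊕ Option ι →₀ ℕ} (hM : IsInconsistentStep w d A M) (s : κ → F) (i₁ : κ)
    (g : Matrix κ κ F) {h : MvPowerSeries (κ ⊕ Option ι) F}
    (h0 : MvPowerSeries.constantCoeff h = 0) (hh : LatentZero M h) :
    Corresponds (interimB M) (excFactor M A) (interimTransform w M s i₁ g h)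
      (latentForm w A M s i₁ g h) := by
  have hden := hM.denominator_ne_zero
  have hsyn := toSynthetic_corresponds hden hh
  refine (hM.corresponds_firstTransform.localize s).reduce (vecMul_interimB_bijective hden) hsyn
    ?_ h0 i₁ g
  have := hsyn 0 0
  rw [Matrix.zero_vecMul, sub_zero] at this
  rw [constantCoeff_eq_ratExt, ← this, ← constantCoeff_eq_ratExt, h0]

end FirstStepCorrespondence

/-! ### The correspondence of terms after both steps -/

section SecondStepCorrespondence

variable {F : Type*} [NormedField F] {κ ι μ θ : Type*}
  [Fintype κ] [DecidableEq κ] [Fintype ι] [DecidableEq ι]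
  [Fintype μ] [DecidableEq μ] [Fintype θ] [DecidableEq θ]
  {A A' : κ ⊕ Option ι →₀ ℕ} {M : Matrix (κ ⊕ Option ι) (κ ⊕ Option ι) ℕ}
  {M' : Matrix (κ ⊕ Option ι) ((κ ⊕ μ) ⊕ θ) ℕ} {ρ π : Option ι ≃ μ ⊕ θ}

/-- The correspondence in terms of full exponents, of which also the `κ`-part may be rational. -/
theorem Corresponds.ratExt_coeff {a : Option ι → ℚ} {f f' : MvPowerSeries (κ ⊕ Option ι) F}
    (h : Corresponds (interimB M) a f f') (b : κ ⊕ Option ι → ℚ) :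
    ratExt (fun α => MvPowerSeries.coeff α f')
      (Matrix.vecMul b (interimT M) - Sum.elim (0 : κ → ℚ) a) =
      ratExt (fun α => MvPowerSeries.coeff α f) b := by
  have e : Matrix.vecMul b (interimT M) - Sum.elim (0 : κ → ℚ) a =
      Sum.elim (b ∘ Sum.inl) (Matrix.vecMul (b ∘ Sum.inr) (interimB M) - a) := by
    rw [vecMul_interimT]
    ext i; cases i <;> simp
  rw [e]
  by_cases hb : ∃ η, toRat η = b ∘ Sum.inl
  · obtain ⟨η, hη⟩ := hb
    rw [← hη, ratExt_coeff_sumElim, h, ← ratExt_coeff_sumElim, hη, Sum.elim_comp_inl_inr]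
  · have key : ∀ q : κ ⊕ Option ι → ℚ, q ∘ Sum.inl = b ∘ Sum.inl → ¬∃ α, toRat α = q := by
      rintro q hq ⟨α, rfl⟩
      exact hb ⟨(Finsupp.sumFinsuppEquivProdFinsupp α).1, by rw [← hq]; ext i; simp [toRat]⟩
    rw [ratExt_of_not_exists _ (key _ (Sum.elim_comp_inl _ _)), ratExt_of_not_exists _ (key _ rfl)]

/-- The exponents of the exceptional factor of the synthetic transform. -/
noncomputable def synFactor (A A' : κ ⊕ Option ι →₀ ℕ) (M : Matrix (κ ⊕ Option ι) (κ ⊕ Option ι) ℕ)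
    (M' : Matrix (κ ⊕ Option ι) ((κ ⊕ μ) ⊕ θ) ℕ) (ρ : Option ι ≃ μ ⊕ θ) : θ → ℚ :=
  fun j => Matrix.vecMul (toRat A' + Sum.elim (0 : κ → ℚ) (excFactor M A))
    (canonicalReduction (rowLabels ρ) (ratMatrix M')) (Sum.inr j)

/-- The exponents `α` of `X'`, `β` of the synthetic variables and `γ` of `T'` belong to the same term of
the latent apex form, the interim transform and the synthetic transform. -/
structure IsMatched (A A' : κ ⊕ Option ι →₀ ℕ) (M : Matrix (κ ⊕ Option ι) (κ ⊕ Option ι) ℕ)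
    (M' : Matrix (κ ⊕ Option ι) ((κ ⊕ μ) ⊕ θ) ℕ) (ρ π : Option ι ≃ μ ⊕ θ)
    (α β : κ ⊕ Option ι →₀ ℕ) (γ : (κ ⊕ μ) ⊕ θ →₀ ℕ) : Prop where
  left : Matrix.vecMul (toRat β) (interimT M) = toRat α + Sum.elim (0 : κ → ℚ) (excFactor M A)
  right : Matrix.vecMul (toRat β) (syntheticReduced M M' ρ π) =
    toRat γ + Sum.elim (0 : κ ⊕ μ → ℚ) (synFactor A A' M M' ρ)

theorem vecMul_syntheticReduced_inr (b : κ ⊕ Option ι → ℚ) (e : θ) :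
    Matrix.vecMul b (syntheticReduced M M' ρ π) (Sum.inr e) =
      ∑ j, Matrix.vecMul b (interimT M) j * M' j (Sum.inr e) := by
  rw [syntheticReduced, vecMul_canonicalReduction_inr, syntheticMatrix, ← Matrix.vecMul_vecMul,
    vecMul_canonicalReduction_inr]
  rfl

theorem synFactor_apply (e : θ) :
    synFactor A A' M M' ρ e = ∑ j, (toRat A' + Sum.elim (0 : κ → ℚ) (excFactor M A)) j *
      M' j (Sum.inr e) :=
  rfl

namespace IsMatched

variable {α β : κ ⊕ Option ι →₀ ℕ} {γ : (κ ⊕ μ) ⊕ θ →₀ ℕ}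

theorem apply_inl (h : IsMatched A A' M M' ρ π α β γ) (m : κ ⊕ μ) :
    γ (Sum.inl m) = β ((rowLabels π).symm (Sum.inl m)) := by
  have := congrFun h.right (Sum.inl m)
  rw [syntheticReduced, vecMul_canonicalReduction_inl] at this
  simpa [toRat] using this.symm

theorem apply_inl_left (h : IsMatched A A' M M' ρ π α β γ) (i : κ) :
    β (Sum.inl i) = α (Sum.inl i) := by
  have := congrFun h.left (Sum.inl i)
  rw [vecMul_interimT] at this
  simpa [toRat] using this

theorem apply_inr (h : IsMatched A A' M M' ρ π α β γ) (e : θ) :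
    γ (Sum.inr e) + ∑ j, A' j * M' j (Sum.inr e) = ∑ j, α j * M' j (Sum.inr e) := by
  have h1 := congrFun h.right (Sum.inr e)
  rw [vecMul_syntheticReduced_inr, h.left, Pi.add_apply, Sum.elim_inr, synFactor_apply] at h1
  simp only [Pi.add_apply, add_mul, Finset.sum_add_distrib, toRat] at h1
  have h2 : ((γ (Sum.inr e) + ∑ j, A' j * M' j (Sum.inr e) : ℕ) : ℚ) =
      ((∑ j, α j * M' j (Sum.inr e) : ℕ) : ℚ) := by
    push_cast
    linarith
  exact_mod_cast h2

theorem eq_of_left (hden : latentDenominator M ≠ 0) (h : IsMatched A A' M M' ρ π α β γ)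
    {β' : κ ⊕ Option ι →₀ ℕ} {γ' : (κ ⊕ μ) ⊕ θ →₀ ℕ} (h' : IsMatched A A' M M' ρ π α β' γ') :
    γ = γ' := by
  have hβ : β = β' :=
    toRat_injective ((vecMul_interimT_bijective hden).1 (h.left.trans h'.left.symm))
  subst hβ
  exact toRat_injective (add_right_cancel (h.right.symm.trans h'.right))

theorem eq_of_right (hQ : SustainsLatency M M' ρ π) (h : IsMatched A A' M M' ρ π α β γ)
    {α' β' : κ ⊕ Option ι →₀ ℕ} (h' : IsMatched A A' M M' ρ π α' β' γ) :
    α = α' := by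
  have hβ : β = β' :=
    toRat_injective (vecMul_canonicalReduction_injective _ _ hQ.det_exc
      (h.right.trans h'.right.symm))
  subst hβ
  exact toRat_injective (add_right_cancel (h.left.symm.trans h'.left))

end IsMatched

variable {f fI : MvPowerSeries (κ ⊕ Option ι) F}

/-- No term of the interim transform is lost in the synthetic transform. -/
theorem exists_exponent_syntheticTransform (hc : Corresponds (interimB M) (excFactor M A) fI f)
    (hexp : IsExponentialMatrix f A' M') {β : κ ⊕ Option ι →₀ ℕ}
    (hβ : MvPowerSeries.coeff β fI ≠ 0) :
    ∃ α γ, IsMatched A A' M M' ρ π α β γ ∧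
      MvPowerSeries.coeff α f = MvPowerSeries.coeff β fI := by
  have h1 := hc.ratExt_coeff (toRat β)
  rw [ratExt_toRat (fun α => MvPowerSeries.coeff α fI)] at h1
  obtain ⟨α, hα, hα'⟩ := exists_of_ratExt_ne_zero (h1.trans_ne hβ)
  have hleft : Matrix.vecMul (toRat β) (interimT M) =
      toRat α + Sum.elim (0 : κ → ℚ) (excFactor M A) := by rw [hα, sub_add_cancel]
  obtain ⟨γ, hγ⟩ := exists_toRat_eq (q := Matrix.vecMul (toRat β) (syntheticReduced M M' ρ π) -
      Sum.elim (0 : κ ⊕ μ → ℚ) (synFactor A A' M M' ρ)) fun j => by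
    cases j with
    | inl m =>
      refine ⟨β ((rowLabels π).symm (Sum.inl m)), ?_⟩
      rw [Pi.sub_apply, syntheticReduced, vecMul_canonicalReduction_inl]
      simp [toRat]
    | inr e =>
      refine ⟨∑ i, α i * M' i (Sum.inr e) - ∑ i, A' i * M' i (Sum.inr e), ?_⟩
      rw [Nat.cast_sub (hexp.sum_le_sum (by rw [hα', h1]; exact hβ) _), Pi.sub_apply,
        vecMul_syntheticReduced_inr, hleft, Sum.elim_inr, synFactor_apply]
      simp only [Pi.add_apply, add_mul, Finset.sum_add_distrib, toRat]
      push_cast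
      ring
  exact ⟨α, γ, ⟨hleft, by rw [hγ, sub_add_cancel]⟩, hα'.trans h1⟩

theorem coeff_syntheticTransform (hc : Corresponds (interimB M) (excFactor M A) fI f)
    (hexp : IsExponentialMatrix f A' M') (hQ : SustainsLatency M M' ρ π)
    {α β : κ ⊕ Option ι →₀ ℕ} {γ : (κ ⊕ μ) ⊕ θ →₀ ℕ} (h : IsMatched A A' M M' ρ π α β γ) :
    MvPowerSeries.coeff γ (syntheticTransform fI A A' M M' ρ π) = MvPowerSeries.coeff α f := by
  have h1 := hc.ratExt_coeff (toRat β)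
  have h2 := ratExt_partialTransform (a := synFactor A A' M M' ρ) (w := fI)
    (vecMul_canonicalReduction_injective _ _ hQ.det_exc) (fun β hβ => by
      obtain ⟨α, γ, hm, -⟩ := exists_exponent_syntheticTransform (ρ := ρ) (π := π) hc hexp hβ
      exact ⟨γ, hm.right⟩) (toRat β)
  change ratExt _ (Matrix.vecMul (toRat β) (syntheticReduced M M' ρ π) - _) = _ at h2
  rw [h.left, add_sub_cancel_right, ratExt_toRat] at h1
  rw [h.right, add_sub_cancel_right, ratExt_toRat, ← h1] at h2
  exact h2

theorem exists_isMatched_of_coeff_ne_zero (hden : latentDenominator M ≠ 0)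
    (hc : Corresponds (interimB M) (excFactor M A) fI f)
    (hexp : IsExponentialMatrix f A' M') {α : κ ⊕ Option ι →₀ ℕ}
    (hα : MvPowerSeries.coeff α f ≠ 0) :
    ∃ β γ, IsMatched A A' M M' ρ π α β γ := by
  obtain ⟨b, hb⟩ := (vecMul_interimT_bijective hden).2
    (toRat α + Sum.elim (0 : κ → ℚ) (excFactor M A))
  dsimp only at hb
  have h1 := hc.ratExt_coeff b
  rw [hb, add_sub_cancel_right, ratExt_toRat] at h1
  obtain ⟨β, rfl, hβ⟩ := exists_of_ratExt_ne_zero (h1.symm.trans_ne hα)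
  obtain ⟨α', γ, hm, -⟩ := exists_exponent_syntheticTransform (A := A) (A' := A') (M' := M')
    (ρ := ρ) (π := π) hc hexp (hβ.trans_ne (h1.symm.trans_ne hα))
  have : α' = α := toRat_injective (add_right_cancel (hm.left.symm.trans hb))
  subst this
  exact ⟨β, γ, hm⟩

theorem exists_isMatched_of_coeff_syntheticTransform_ne_zero
    (hc : Corresponds (interimB M) (excFactor M A) fI f)
    (hexp : IsExponentialMatrix f A' M') {γ : (κ ⊕ μ) ⊕ θ →₀ ℕ}
    (hγ : MvPowerSeries.coeff γ (syntheticTransform fI A A' M M' ρ π) ≠ 0) :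
    ∃ α β, IsMatched A A' M M' ρ π α β γ := by
  change ∑ᶠ (β : κ ⊕ Option ι →₀ ℕ) (_ : Matrix.vecMul (toRat β) (syntheticReduced M M' ρ π) =
    toRat γ + Sum.elim (0 : κ ⊕ μ → ℚ) (synFactor A A' M M' ρ)), MvPowerSeries.coeff β fI ≠ 0 at hγ
  obtain ⟨β, hright, hβ'⟩ : ∃ β : κ ⊕ Option ι →₀ ℕ,
      Matrix.vecMul (toRat β) (syntheticReduced M M' ρ π) =
        toRat γ + Sum.elim (0 : κ ⊕ μ → ℚ) (synFactor A A' M M' ρ) ∧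
      MvPowerSeries.coeff β fI ≠ 0 := by
    by_contra! hall
    refine hγ (finsum_eq_zero_of_forall_eq_zero fun β => ?_)
    by_cases hβ : Matrix.vecMul (toRat β) (syntheticReduced M M' ρ π) =
        toRat γ + Sum.elim (0 : κ ⊕ μ → ℚ) (synFactor A A' M M' ρ)
    · simp [hall β hβ]
    · simp [hβ]
  obtain ⟨α, γ', hm, -⟩ := exists_exponent_syntheticTransform (A := A) (A' := A') (M' := M')
    (ρ := ρ) (π := π) hc hexp hβ'
  have : γ' = γ := toRat_injective (add_right_cancel (hm.right.symm.trans hright))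
  subst this
  exact ⟨α, β, hm⟩

/-- The matrix `T̂⁻¹ N_{Q'}` that expresses `X'` in `T'`. -/
noncomputable def transferMatrix (M : Matrix (κ ⊕ Option ι) (κ ⊕ Option ι) ℕ)
    (M' : Matrix (κ ⊕ Option ι) ((κ ⊕ μ) ⊕ θ) ℕ) (ρ π : Option ι ≃ μ ⊕ θ) :
    Matrix (κ ⊕ Option ι) ((κ ⊕ μ) ⊕ θ) ℚ :=
  (interimT M)⁻¹ * syntheticReduced M M' ρ π

theorem interimT_mul_inv (hden : latentDenominator M ≠ 0) : interimT M * (interimT M)⁻¹ = 1 :=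
  Matrix.mul_nonsing_inv _ ((Matrix.isUnit_iff_isUnit_det _).1
    (Matrix.vecMul_injective_iff_isUnit.1 (vecMul_interimT_bijective hden).1))

theorem vecMul_interimT_transferMatrix (hden : latentDenominator M ≠ 0) (b : κ ⊕ Option ι → ℚ) :
    Matrix.vecMul (Matrix.vecMul b (interimT M)) (transferMatrix M M' ρ π) =
      Matrix.vecMul b (syntheticReduced M M' ρ π) := by
  rw [transferMatrix, Matrix.vecMul_vecMul, ← Matrix.mul_assoc, interimT_mul_inv hden,
    Matrix.one_mul]

theorem transferMatrix_inr (hden : latentDenominator M ≠ 0) (j : κ ⊕ Option ι) (e : θ) :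
    transferMatrix M M' ρ π j (Sum.inr e) = M' j (Sum.inr e) := by
  obtain ⟨b, hb⟩ := (vecMul_interimT_bijective hden).2 (Pi.single j 1)
  dsimp only at hb
  have h1 := congrFun (vecMul_interimT_transferMatrix (M' := M') (ρ := ρ) (π := π) hden b)
    (Sum.inr e)
  rw [vecMul_syntheticReduced_inr, hb, Matrix.single_one_vecMul] at h1
  simpa [Pi.single_apply] using h1

/-- The exponents of `T'` depend affinely on those of `X'`. -/
theorem IsMatched.toRat_eq (hden : latentDenominator M ≠ 0) {α β : κ ⊕ Option ι →₀ ℕ}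
    {γ : (κ ⊕ μ) ⊕ θ →₀ ℕ} (h : IsMatched A A' M M' ρ π α β γ) :
    toRat γ = Matrix.vecMul (toRat α) (transferMatrix M M' ρ π) +
      (Matrix.vecMul (Sum.elim (0 : κ → ℚ) (excFactor M A)) (transferMatrix M M' ρ π) -
        Sum.elim (0 : κ ⊕ μ → ℚ) (synFactor A A' M M' ρ)) := by
  rw [← add_sub_assoc, ← Matrix.add_vecMul, ← h.left, vecMul_interimT_transferMatrix hden, h.right,
    add_sub_cancel_right]

/-- The exponents of `t'_1, …, t'_l` in a term of latent component zero with exponents `α` of `X'`,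
up to a constant shift. -/
noncomputable def baseExponent (π : Option ι ≃ μ ⊕ θ) (α : κ ⊕ Option ι →₀ ℕ) : κ ⊕ μ →₀ ℕ :=
  Finsupp.equivFunOnFinite.symm fun m => α ((rowLabels π).symm (Sum.inl m))

theorem baseExponent_apply (α : κ ⊕ Option ι →₀ ℕ) (m : κ ⊕ μ) :
    baseExponent π α m = α ((rowLabels π).symm (Sum.inl m)) := rfl

theorem baseExponent_inl (α : κ ⊕ Option ι →₀ ℕ) (i : κ) :
    baseExponent π α (Sum.inl i) = α (Sum.inl i) := rfl

theorem baseExponent_add (α α' : κ ⊕ Option ι →₀ ℕ) :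
    baseExponent π (α + α') = baseExponent π α + baseExponent π α' := by
  ext m; simp [baseExponent_apply]

theorem rowLabels_symm_inl_ne_none (hπ : ∃ j : θ, π none = Sum.inr j) (m : κ ⊕ μ) :
    (rowLabels π).symm (Sum.inl m) ≠ (Sum.inr none : κ ⊕ Option ι) := by
  intro h
  rw [Equiv.symm_apply_eq] at h
  obtain ⟨j, hj⟩ := hπ
  simp [rowLabels, hj] at h

/-- The weights of the variables `X'` on the face of the second step. -/
def rowWeight (M' : Matrix (κ ⊕ Option ι) ((κ ⊕ μ) ⊕ θ) ℕ) (j : κ ⊕ Option ι) : ℕ :=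
  ∑ e, M' j (Sum.inr e)

/-- Exponents of latent component zero are transformed by row deletion, without fractions. -/
theorem toRat_baseExponent_eq (hden : latentDenominator M ≠ 0)
    (hπ : ∃ j : θ, π none = Sum.inr j) {α : κ ⊕ Option ι →₀ ℕ} (hα : latentComponent M α = 0) :
    toRat (Finsupp.sumElim (baseExponent π α)
      (Finsupp.equivFunOnFinite.symm fun e => ∑ j, α j * M' j (Sum.inr e))) =
      Matrix.vecMul (toRat α) (transferMatrix M M' ρ π) := by
  have h1 := toRat_eq_vecMul_of_latentComponent_eq_zero hden hα
  ext k
  cases k with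
  | inl m =>
    rw [h1, vecMul_interimT_transferMatrix hden, syntheticReduced, vecMul_canonicalReduction_inl]
    simp [toRat, baseExponent_apply, Finsupp.erase_ne (rowLabels_symm_inl_ne_none hπ m)]
  | inr e =>
    simp [toRat, Matrix.vecMul, dotProduct, transferMatrix_inr hden]

end SecondStepCorrespondence

/-! ### Radii and convergence -/

section Radii

theorem prod_rpow_of_vecMul {ν ν' : Type*} [Fintype ν] [Fintype ν'] {T : ν' → ℝ}
    (hT : ∀ k, 0 < T k) {P : Matrix ν ν' ℚ} {c : ν' → ℚ} {α : ν →₀ ℕ} {γ : ν' →₀ ℕ}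
    (h : toRat γ = Matrix.vecMul (toRat α) P + c) :
    ∏ k, T k ^ γ k =
      (∏ j, (∏ k, T k ^ ((P j k : ℚ) : ℝ)) ^ α j) * ∏ k, T k ^ ((c k : ℚ) : ℝ) := by
  simp only [← Finset.prod_pow]
  rw [Finset.prod_comm, ← Finset.prod_mul_distrib]
  refine Finset.prod_congr rfl fun k _ => ?_
  have h1 : (γ k : ℝ) = ∑ j, (α j : ℝ) * ((P j k : ℚ) : ℝ) + ((c k : ℚ) : ℝ) := by
    have := congrFun h k
    simp only [toRat, Pi.add_apply, Matrix.vecMul, dotProduct] at this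
    exact_mod_cast congrArg (Rat.cast : ℚ → ℝ) this
  rw [← Real.rpow_natCast, h1, Real.rpow_add (hT k), Real.rpow_sum_of_pos (hT k)]
  congr 1
  refine Finset.prod_congr rfl fun j _ => ?_
  rw [← Real.rpow_natCast, ← Real.rpow_mul (hT k).le, mul_comm]

variable {F : Type*} [NormedField F] {κ ι μ θ : Type*}
  [Fintype κ] [DecidableEq κ] [Fintype ι] [DecidableEq ι]
  [Fintype μ] [DecidableEq μ] [Fintype θ] [DecidableEq θ]
  {A A' : κ ⊕ Option ι →₀ ℕ} {M : Matrix (κ ⊕ Option ι) (κ ⊕ Option ι) ℕ}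
  {M' : Matrix (κ ⊕ Option ι) ((κ ⊕ μ) ⊕ θ) ℕ} {ρ π : Option ι ≃ μ ⊕ θ}

/-- The polydisc around `(t, 0)` of radius `r` as a vector of positive reals. -/
noncomputable def discRadius (t : κ ⊕ μ → F) (r : ℝ) : (κ ⊕ μ) ⊕ θ → ℝ :=
  Sum.elim (fun m => ‖t m‖ + r) fun _ => r

theorem discRadius_pos (t : κ ⊕ μ → F) {r : ℝ} (hr : 0 < r) (k : (κ ⊕ μ) ⊕ θ) :
    0 < discRadius t r k := by
  cases k with
  | inl m => exact add_pos_of_nonneg_of_pos (norm_nonneg _) hr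
  | inr e => exact hr

/-- Near `(t, 0)` all the coordinates `x'_j` have absolute value less than `δ`: the deficient ones by
hypothesis, the others because they contain an exceptional variable. -/
theorem exists_radius (hden : latentDenominator M ≠ 0) {t : κ ⊕ μ → F} (ht : ∀ m, t m ≠ 0) {δ : ℝ}
    (hδ : 0 < δ) (hmod : ∀ j, IsDeficient M' j → modulus M M' ρ π t j < δ) :
    ∃ r : ℝ, 0 < r ∧ ∀ j : κ ⊕ Option ι,
      ∏ k, discRadius t r k ^ ((transferMatrix M M' ρ π j k : ℚ) : ℝ) < δ := by
  have key : ∀ j : κ ⊕ Option ι, ∀ᶠ r : ℝ in nhdsWithin 0 (Set.Ioi 0),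
      ∏ k, discRadius t r k ^ ((transferMatrix M M' ρ π j k : ℚ) : ℝ) < δ := by
    intro j
    have heq : ∀ r : ℝ, 0 < r → ∏ k, discRadius t r k ^ ((transferMatrix M M' ρ π j k : ℚ) : ℝ) =
        (∏ m, (‖t m‖ + r) ^ ((transferMatrix M M' ρ π j (Sum.inl m) : ℚ) : ℝ)) *
          r ^ rowWeight M' j := by
      intro r hr
      rw [Fintype.prod_sum_type, rowWeight, ← Finset.prod_pow_eq_pow_sum]
      congr 1
      refine Finset.prod_congr rfl fun e _ => ?_
      rw [transferMatrix_inr hden, Rat.cast_natCast, Real.rpow_natCast]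
      rfl
    have hcont : ContinuousAt (fun r : ℝ =>
        (∏ m, (‖t m‖ + r) ^ ((transferMatrix M M' ρ π j (Sum.inl m) : ℚ) : ℝ)) *
          r ^ rowWeight M' j) 0 := by
      refine ContinuousAt.mul (tendsto_finsetProd _ fun m _ => ?_) (by fun_prop)
      refine ContinuousAt.rpow_const (by fun_prop) (Or.inl ?_)
      rw [add_zero]
      exact norm_ne_zero_iff.2 (ht m)
    have hval : (∏ m, (‖t m‖ + 0) ^ ((transferMatrix M M' ρ π j (Sum.inl m) : ℚ) : ℝ)) *
        (0 : ℝ) ^ rowWeight M' j < δ := by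
      by_cases hj : IsDeficient M' j
      · have : rowWeight M' j = 0 := Finset.sum_eq_zero fun e _ => hj e
        rw [this, pow_zero, mul_one]
        simpa [modulus, transferMatrix] using hmod j hj
      · have : rowWeight M' j ≠ 0 := fun h => hj fun e =>
          (Finset.sum_eq_zero_iff.1 h) e (Finset.mem_univ e)
        rw [zero_pow this, mul_zero]
        exact hδ
    filter_upwards [nhdsWithin_le_nhds (hcont.eventually_lt_const hval), self_mem_nhdsWithin]
      with r h1 h2
    rw [heq r h2]
    exact h1
  obtain ⟨r, h1, h2⟩ := ((Filter.eventually_all.2 key).and self_mem_nhdsWithin).exists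
  exact ⟨r, h2, h1⟩

/-- Comparison test along a relation that assigns to each `x` at most one `y`. -/
theorem summable_of_matching {X Y : Type*} {u : Y → ℝ} {v : X → ℝ} (R : X → Y → Prop)
    (hv : Summable v) (hu : ∀ y, 0 ≤ u y) (h : ∀ y, u y ≠ 0 → ∃ x, R x y ∧ u y ≤ v x)
    (hR : ∀ x y y', R x y → R x y' → y = y') : Summable u := by
  choose i hi using fun y : Function.support u => h y.1 y.2
  have hinj : Function.Injective i := fun y y' hy =>
    Subtype.ext (hR (i y) _ _ (hi y).1 (hy ▸ (hi y').1))
  rw [← Subtype.val_injective.summable_iff (g := (Subtype.val : Function.support u → Y))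
    (f := u)]
  · exact Summable.of_nonneg_of_le (fun y => hu _) (fun y => (hi y).2) (hv.comp_injective hinj)
  · intro y hy
    by_contra hne
    exact hy ⟨⟨y, hne⟩, rfl⟩

/-- The synthetic transform converges where the radii of `X'` belong to the polydisc of convergence of
the latent apex form. -/
theorem convergesAt_syntheticTransform (hden : latentDenominator M ≠ 0)
    {f fI : MvPowerSeries (κ ⊕ Option ι) F}
    (hc : Corresponds (interimB M) (excFactor M A) fI f)
    (hexp : IsExponentialMatrix f A' M') (hQ : SustainsLatency M M' ρ π) {δ : ℝ}
    (hf : Summable fun α : κ ⊕ Option ι →₀ ℕ => ‖MvPowerSeries.coeff α f‖ * ∏ i, δ ^ α i)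
    {t : κ ⊕ μ → F} {r : ℝ} (hr : 0 < r)
    (hX : ∀ j : κ ⊕ Option ι,
      ∏ k, discRadius t r k ^ ((transferMatrix M M' ρ π j k : ℚ) : ℝ) < δ) :
    ConvergesAt (syntheticTransform fI A A' M M' ρ π) (Sum.elim t 0) := by
  refine ⟨r, hr, ?_⟩
  have hT := discRadius_pos (θ := θ) t hr
  have heq : ∀ k : (κ ⊕ μ) ⊕ θ, ‖Sum.elim t 0 k‖ + r = discRadius t r k := by
    intro k; cases k <;> simp [discRadius]
  simp only [heq]
  set c : (κ ⊕ μ) ⊕ θ → ℚ :=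
    Matrix.vecMul (Sum.elim (0 : κ → ℚ) (excFactor M A)) (transferMatrix M M' ρ π) -
      Sum.elim (0 : κ ⊕ μ → ℚ) (synFactor A A' M M' ρ)
  refine summable_of_matching (fun α γ => ∃ β, IsMatched A A' M M' ρ π α β γ)
    (hf.mul_right (∏ k, discRadius t r k ^ ((c k : ℚ) : ℝ)))
    (fun γ => mul_nonneg (norm_nonneg _) (Finset.prod_nonneg fun k _ => (pow_pos (hT k) _).le))
    (fun γ hγ => ?_) ?_
  · obtain ⟨α, β, hm⟩ := exists_isMatched_of_coeff_syntheticTransform_ne_zero hc hexp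
      (norm_ne_zero_iff.1 (left_ne_zero_of_mul hγ))
    refine ⟨α, ⟨β, hm⟩, ?_⟩
    rw [coeff_syntheticTransform hc hexp hQ hm, prod_rpow_of_vecMul hT (hm.toRat_eq hden),
      mul_assoc]
    refine mul_le_mul_of_nonneg_left (mul_le_mul_of_nonneg_right ?_ ?_) (norm_nonneg _)
    · exact Finset.prod_le_prod (fun j _ => pow_nonneg
        (Finset.prod_nonneg fun k _ => (Real.rpow_pos_of_pos (hT k) _).le) _)
        fun j _ => pow_le_pow_left₀
          (Finset.prod_nonneg fun k _ => (Real.rpow_pos_of_pos (hT k) _).le) (hX j).le _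
    · exact Finset.prod_nonneg fun k _ => (Real.rpow_pos_of_pos (hT k) _).le
  · rintro α γ γ' ⟨β, hm⟩ ⟨β', hm'⟩
    exact hm.eq_of_left hden hm'

end Radii

/-! ### Restriction of monomials to the axis through a point -/

section Axis

variable {F σ : Type*} [NormedField F] [Fintype σ] [DecidableEq σ]

/-- The monomial with exponents `η` along the line through `t` in the direction of the coordinate `i`,
as a series in the increment of that coordinate. -/
noncomputable def axisMonomial (t : σ → F) (i : σ) (η : σ →₀ ℕ) : PowerSeries F :=
  ∏ k, (PowerSeries.C (t k) + if k = i then PowerSeries.X else 0) ^ η k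

theorem axisMonomial_add (t : σ → F) (i : σ) (η η' : σ →₀ ℕ) :
    axisMonomial t i (η + η') = axisMonomial t i η * axisMonomial t i η' := by
  simp only [axisMonomial, Finsupp.add_apply, pow_add, Finset.prod_mul_distrib]

theorem coeff_C_add_X_pow (a : F) (n m : ℕ) :
    PowerSeries.coeff m ((PowerSeries.C a + PowerSeries.X) ^ n) =
      (n.choose m : F) * a ^ (n - m) := by
  have := Polynomial.coeff_X_add_C_pow a n m
  rw [← Polynomial.coeff_coe, Polynomial.coe_pow, Polynomial.coe_add, Polynomial.coe_X,
    Polynomial.coe_C, add_comm] at this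
  rw [this, mul_comm]

theorem coeff_axisMonomial (t : σ → F) (i : σ) (η : σ →₀ ℕ) (m : ℕ) :
    PowerSeries.coeff m (axisMonomial t i η) =
      ∏ k, ((η k).choose (Finsupp.single i m k) : F) * t k ^ (η k - Finsupp.single i m k) := by
  rw [axisMonomial, Fintype.prod_eq_mul_prod_compl i, Fintype.prod_eq_mul_prod_compl i]
  have h1 : ∏ k ∈ ({i} : Finset σ)ᶜ,
      (PowerSeries.C (t k) + if k = i then PowerSeries.X else 0) ^ η k =
      PowerSeries.C (∏ k ∈ ({i} : Finset σ)ᶜ, t k ^ η k) := by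
    rw [map_prod]
    refine Finset.prod_congr rfl fun k hk => ?_
    have : k ≠ i := by simpa using hk
    rw [if_neg this, add_zero, map_pow]
  have h2 : ∏ k ∈ ({i} : Finset σ)ᶜ,
      ((η k).choose (Finsupp.single i m k) : F) * t k ^ (η k - Finsupp.single i m k) =
      ∏ k ∈ ({i} : Finset σ)ᶜ, t k ^ η k := by
    refine Finset.prod_congr rfl fun k hk => ?_
    have : k ≠ i := by simpa using hk
    simp [Finsupp.single_eq_of_ne this]
  rw [h1, h2, if_pos rfl, mul_comm, PowerSeries.coeff_C_mul, coeff_C_add_X_pow,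
    Finsupp.single_eq_same, mul_comm]

theorem coeff_axisMonomial_of_lt (t : σ → F) (i : σ) {η : σ →₀ ℕ} {m : ℕ} (h : η i < m) :
    PowerSeries.coeff m (axisMonomial t i η) = 0 := by
  rw [coeff_axisMonomial, Fintype.prod_eq_mul_prod_compl i, Finsupp.single_eq_same,
    Nat.choose_eq_zero_of_lt h, Nat.cast_zero, zero_mul, zero_mul]

theorem axisMonomial_of_apply_eq_zero (t : σ → F) {i : σ} {η : σ →₀ ℕ} (h : η i = 0) :
    axisMonomial t i η = PowerSeries.C (∏ k, t k ^ η k) := by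
  rw [axisMonomial, map_prod]
  refine Finset.prod_congr rfl fun k _ => ?_
  by_cases hk : k = i
  · subst hk; simp [h]
  · simp [hk]

theorem choose_mul_pow_mul_pow_le {a r : ℝ} (ha : 0 ≤ a) (hr : 0 ≤ r) (n m : ℕ) :
    (n.choose m : ℝ) * a ^ (n - m) * r ^ m ≤ (a + r) ^ n := by
  rcases le_or_gt m n with h | h
  · rw [add_comm a r, add_pow]
    refine le_trans (le_of_eq ?_) (Finset.single_le_sum
      (f := fun k => r ^ k * a ^ (n - k) * (n.choose k : ℝ)) (fun k _ => by positivity)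
      (Finset.mem_range_succ_iff.2 h))
    ring
  · rw [Nat.choose_eq_zero_of_lt h]
    simp only [Nat.cast_zero, zero_mul]
    positivity

theorem norm_coeff_axisMonomial_mul_le (t : σ → F) (i : σ) (η : σ →₀ ℕ) (m : ℕ) {r : ℝ}
    (hr : 0 ≤ r) :
    ‖PowerSeries.coeff m (axisMonomial t i η)‖ * r ^ m ≤ ∏ k, (‖t k‖ + r) ^ η k := by
  have h1 : r ^ m = ∏ k, r ^ (Finsupp.single i m k) := by
    rw [Finset.prod_pow_eq_pow_sum]
    simp [Finsupp.single_apply]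
  rw [coeff_axisMonomial, norm_prod, h1, ← Finset.prod_mul_distrib]
  refine Finset.prod_le_prod (fun k _ => by positivity) fun k _ => ?_
  refine le_trans (mul_le_mul_of_nonneg_right ?_ (by positivity))
    (choose_mul_pow_mul_pow_le (norm_nonneg (t k)) hr (η k) (Finsupp.single i m k))
  rw [norm_mul, norm_pow]
  refine mul_le_mul_of_nonneg_right ?_ (by positivity)
  simpa using Nat.norm_cast_le (α := F) ((η k).choose (Finsupp.single i m k))

theorem coeff_onAxis_proper_localize {τ : Type*} (t : σ → F) (i : σ)
    (p : MvPowerSeries (σ ⊕ τ) F) (m : ℕ) :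
    PowerSeries.coeff m (onAxis i (proper (localize t p))) =
      ∑' η : σ →₀ ℕ, MvPowerSeries.coeff (Finsupp.sumElim η 0) p *
        PowerSeries.coeff m (axisMonomial t i η) := by
  rw [onAxis, PowerSeries.coeff_mk]
  change ∑' η : σ →₀ ℕ, _ = _
  refine tsum_congr fun η => ?_
  rw [coeff_axisMonomial]
  congr 3
  ext e
  cases e <;> simp

end Axis

section AxisSum

variable {F σ ν : Type*} [NormedField F] [Fintype σ] [DecidableEq σ]

/-- The series `∑ G_α t^φ(α)` along the line through `t` in the direction of the coordinate `i`. -/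
noncomputable def axisSum (t : σ → F) (i : σ) (φ : (ν →₀ ℕ) → σ →₀ ℕ) (G : MvPowerSeries ν F) :
    PowerSeries F :=
  PowerSeries.mk fun m =>
    ∑' α, MvPowerSeries.coeff α G * PowerSeries.coeff m (axisMonomial t i (φ α))

/-- Multiplicativity of evaluation along a line, for absolutely convergent series. -/
theorem axisSum_mul [CompleteSpace F] (t : σ → F) (i : σ) {φ : (ν →₀ ℕ) → σ →₀ ℕ}
    (hφ : ∀ α α', φ (α + α') = φ α + φ α') {G H : MvPowerSeries ν F}
    (hG : ∀ m, Summable fun α =>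
      ‖MvPowerSeries.coeff α G * PowerSeries.coeff m (axisMonomial t i (φ α))‖)
    (hH : ∀ m, Summable fun α =>
      ‖MvPowerSeries.coeff α H * PowerSeries.coeff m (axisMonomial t i (φ α))‖) :
    axisSum t i φ (G * H) = axisSum t i φ G * axisSum t i φ H := by
  classical
  ext m
  rw [PowerSeries.coeff_mul]
  simp only [axisSum, PowerSeries.coeff_mk]
  set u : ℕ → (ν →₀ ℕ) → F := fun m α =>
    MvPowerSeries.coeff α G * PowerSeries.coeff m (axisMonomial t i (φ α)) with hu
  set v : ℕ → (ν →₀ ℕ) → F := fun m α =>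
    MvPowerSeries.coeff α H * PowerSeries.coeff m (axisMonomial t i (φ α)) with hv
  change _ = ∑ p ∈ Finset.HasAntidiagonal.antidiagonal m, (∑' α, u p.1 α) * ∑' α, v p.2 α
  have h1 : ∀ p : ℕ × ℕ, Summable fun x : (ν →₀ ℕ) × (ν →₀ ℕ) => u p.1 x.1 * v p.2 x.2 :=
    fun p => summable_mul_of_summable_norm (hG p.1) (hH p.2)
  have h2 : ∀ p : ℕ × ℕ, Summable fun α =>
      ∑ x ∈ Finset.HasAntidiagonal.antidiagonal α, u p.1 x.1 * v p.2 x.2 :=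
    fun p => summable_sum_mul_antidiagonal_of_summable_mul (h1 p)
  have h3 : ∀ p : ℕ × ℕ, (∑' α, u p.1 α) * ∑' α, v p.2 α =
      ∑' α, ∑ x ∈ Finset.HasAntidiagonal.antidiagonal α, u p.1 x.1 * v p.2 x.2 := fun p =>
    (hG p.1).of_norm.tsum_mul_tsum_eq_tsum_sum_antidiagonal (hH p.2).of_norm (h1 p)
  rw [Finset.sum_congr rfl fun p _ => h3 p, ← Summable.tsum_finsetSum fun p _ => h2 p]
  refine tsum_congr fun α => ?_
  simp only [hu, hv]
  rw [MvPowerSeries.coeff_mul, Finset.sum_mul, Finset.sum_comm]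
  refine Finset.sum_congr rfl fun x hx => ?_
  rw [Finset.HasAntidiagonal.mem_antidiagonal] at hx
  rw [← hx, hφ, axisMonomial_add, PowerSeries.coeff_mul, Finset.mul_sum]
  exact Finset.sum_congr rfl fun p _ => by ring

end AxisSum

/-! ### Weierstrass polynomials -/

section Weierstrass

variable {F ν : Type*} [NormedField F] [DecidableEq ν]

/-- The terms of a Weierstrass polynomial: besides the leading term there are only terms of degree at
most `d - 2` in the primary variable that contain another variable. -/
theorem IsWeierstrassPolynomial.eq_single_or {i : ν} {d : ℕ} {w : MvPowerSeries ν F}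
    (hw : IsWeierstrassPolynomial i d w) {α : ν →₀ ℕ} (hα : MvPowerSeries.coeff α w ≠ 0) :
    α = Finsupp.single i d ∨ (α i + 2 ≤ d ∧ α ≠ Finsupp.single i (α i)) := by
  obtain ⟨c, hc, rfl⟩ := hw
  by_contra hcon
  push Not at hcon
  apply hα
  rw [map_add, map_sum, MvPowerSeries.coeff_X_pow, if_neg hcon.1, zero_add]
  refine Finset.sum_eq_zero fun j hj => ?_
  obtain ⟨h2, h3⟩ := Finset.mem_Icc.1 hj
  rw [MvPowerSeries.X_pow_eq, MvPowerSeries.coeff_mul_monomial, mul_one]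
  split_ifs with hle
  · by_contra hne
    have h4 := (hc j hj).2 _ hne
    have h5 : d - j ≤ α i := by simpa using hle i
    have h6 : α i = d - j := by
      simp only [Finsupp.coe_tsub, Pi.sub_apply, Finsupp.single_eq_same] at h4
      omega
    have h7 := hcon.2 (by omega)
    rw [← h6, ← h7, tsub_self, MvPowerSeries.coeff_zero_eq_constantCoeff_apply, (hc j hj).1] at hne
    exact hne rfl
  · rfl

theorem IsWeierstrassPolynomial.coeff_single {i : ν} {d : ℕ} {w : MvPowerSeries ν F}
    (hw : IsWeierstrassPolynomial i d w) : MvPowerSeries.coeff (Finsupp.single i d) w = 1 := by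
  obtain ⟨c, hc, rfl⟩ := hw
  rw [map_add, map_sum, MvPowerSeries.coeff_X_pow, if_pos rfl, add_eq_left]
  refine Finset.sum_eq_zero fun j hj => ?_
  obtain ⟨h2, h3⟩ := Finset.mem_Icc.1 hj
  rw [MvPowerSeries.X_pow_eq, MvPowerSeries.coeff_mul_monomial, mul_one]
  split_ifs with hle
  · by_contra hne
    have h4 := (hc j hj).2 _ hne
    simp only [Finsupp.coe_tsub, Pi.sub_apply, Finsupp.single_eq_same] at h4
    omega
  · rfl

/-- The pure power of the primary variable in the product with a unit. -/
theorem IsWeierstrassPolynomial.coeff_single_mul {i : ν} {d : ℕ} {w u : MvPowerSeries ν F}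
    (hw : IsWeierstrassPolynomial i d w) :
    MvPowerSeries.coeff (Finsupp.single i d) (w * u) = MvPowerSeries.constantCoeff u := by
  rw [MvPowerSeries.coeff_mul, Finset.sum_eq_single (Finsupp.single i d, 0)]
  · rw [hw.coeff_single, one_mul, MvPowerSeries.coeff_zero_eq_constantCoeff_apply]
  · rintro ⟨a, b⟩ hab hne
    rw [Finset.HasAntidiagonal.mem_antidiagonal] at hab
    dsimp only at hab ⊢
    by_cases ha : MvPowerSeries.coeff a w = 0
    · rw [ha, zero_mul]
    · exfalso
      rcases hw.eq_single_or ha with h | ⟨-, h⟩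
      · subst h
        exact hne (by rw [add_eq_left.1 hab])
      · apply h
        ext k
        by_cases hk : k = i
        · subst hk; simp
        · have := DFunLike.congr_fun hab k
          rw [Finsupp.add_apply, Finsupp.single_eq_of_ne hk] at this
          rw [Finsupp.single_eq_of_ne hk]
          omega
  · intro h
    exact absurd (by simp) h

end Weierstrass

/-! ### Choice of the radius -/

section Delta

variable {F ν : Type*} [NormedField F] [Fintype ν]

theorem summable_of_le_radius {f : MvPowerSeries ν F} {ρ δ : ℝ} (hδ : 0 ≤ δ) (h : δ ≤ ρ)
    (hf : Summable fun α : ν →₀ ℕ => ‖MvPowerSeries.coeff α f‖ * ∏ i, ρ ^ α i) :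
    Summable fun α : ν →₀ ℕ => ‖MvPowerSeries.coeff α f‖ * ∏ i, δ ^ α i :=
  Summable.of_nonneg_of_le (fun α => by positivity)
    (fun α => mul_le_mul_of_nonneg_left (Finset.prod_le_prod (fun i _ => by positivity)
      fun i _ => pow_le_pow_left₀ hδ h _) (norm_nonneg _)) hf

theorem Convergent.exists_radius {f : MvPowerSeries ν F} (hf : Convergent f) :
    ∃ ρ : ℝ, 0 < ρ ∧
      Summable fun α : ν →₀ ℕ => ‖MvPowerSeries.coeff α f‖ * ∏ i, ρ ^ α i := by
  obtain ⟨ρ, h1, h2⟩ := hf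
  exact ⟨ρ, h1, by simpa using h2⟩

/-- A convergent series that vanishes at the origin is small on small polydiscs. -/
theorem Convergent.exists_radius_tsum_lt {f : MvPowerSeries ν F} (hf : Convergent f)
    (h0 : MvPowerSeries.constantCoeff f = 0) {ε : ℝ} (hε : 0 < ε) :
    ∃ ρ : ℝ, 0 < ρ ∧ ∀ δ, 0 < δ → δ ≤ ρ →
      (Summable fun α : ν →₀ ℕ => ‖MvPowerSeries.coeff α f‖ * ∏ i, δ ^ α i) ∧
      ∑' α : ν →₀ ℕ, ‖MvPowerSeries.coeff α f‖ * ∏ i, δ ^ α i < ε := by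
  obtain ⟨ρ, hρ, hs⟩ := hf.exists_radius
  set S := ∑' α : ν →₀ ℕ, ‖MvPowerSeries.coeff α f‖ * ∏ i, ρ ^ α i with hS
  have hS0 : 0 ≤ S := tsum_nonneg fun α => by positivity
  refine ⟨min ρ (ρ * ε / (S + 1)), by positivity, fun δ hδ hle => ?_⟩
  have hsδ := summable_of_le_radius hδ.le (hle.trans (min_le_left _ _)) hs
  refine ⟨hsδ, ?_⟩
  have hδρ : δ / ρ ≤ 1 := (div_le_one hρ).2 (hle.trans (min_le_left _ _))
  have hterm : ∀ α : ν →₀ ℕ, ‖MvPowerSeries.coeff α f‖ * ∏ i, δ ^ α i ≤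
      δ / ρ * (‖MvPowerSeries.coeff α f‖ * ∏ i, ρ ^ α i) := by
    intro α
    by_cases hα : α = 0
    · subst hα
      rw [MvPowerSeries.coeff_zero_eq_constantCoeff_apply, h0]
      simp
    · have hdeg : ∑ i, α i ≠ 0 := fun h => hα (by
        ext i
        exact (Finset.sum_eq_zero_iff.1 h) i (Finset.mem_univ i))
      have h1 : ∏ i, δ ^ α i = (δ / ρ) ^ (∑ i, α i) * ∏ i, ρ ^ α i := by
        rw [← Finset.prod_pow_eq_pow_sum, ← Finset.prod_mul_distrib]
        refine Finset.prod_congr rfl fun i _ => ?_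
        rw [div_pow, div_mul_cancel₀ _ (pow_pos hρ _).ne']
      rw [h1, mul_left_comm]
      refine mul_le_mul_of_nonneg_right ?_ (by positivity)
      exact pow_le_of_le_one (by positivity) hδρ hdeg
  have hlt : δ / ρ * S < ε := by
    have h1 : δ ≤ ρ * ε / (S + 1) := hle.trans (min_le_right _ _)
    have h2 : δ / ρ ≤ ε / (S + 1) := by
      rw [div_le_iff₀ hρ]
      calc δ ≤ ρ * ε / (S + 1) := h1
        _ = ε / (S + 1) * ρ := by ring
    calc δ / ρ * S ≤ ε / (S + 1) * S := mul_le_mul_of_nonneg_right h2 hS0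
      _ = ε * (S / (S + 1)) := by ring
      _ < ε * 1 := by
        refine mul_lt_mul_of_pos_left ?_ hε
        rw [div_lt_one (by positivity)]
        linarith
      _ = ε := mul_one ε
  refine lt_of_le_of_lt ?_ hlt
  rw [hS, ← tsum_mul_left]
  exact hsδ.tsum_le_tsum hterm (hs.mul_left _)

end Delta

/-! ### The order along the axis of the primary variable -/

section OrderEstimate

variable {F : Type*} [NormedField F] {κ ι μ θ : Type*}
  [Fintype κ] [DecidableEq κ] [Fintype ι] [DecidableEq ι]
  [Fintype μ] [DecidableEq μ] [Fintype θ] [DecidableEq θ]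
  {A A' : κ ⊕ Option ι →₀ ℕ} {M : Matrix (κ ⊕ Option ι) (κ ⊕ Option ι) ℕ}
  {M' : Matrix (κ ⊕ Option ι) ((κ ⊕ μ) ⊕ θ) ℕ} {ρ π : Option ι ≃ μ ⊕ θ}

theorem weight_rowWeight (α : κ ⊕ Option ι →₀ ℕ) :
    Finsupp.weight (rowWeight M') α = ∑ e, ∑ j, α j * M' j (Sum.inr e) := by
  simp only [Finsupp.weight_apply, smul_eq_mul]
  rw [Finsupp.sum_fintype _ _ (fun _ => zero_mul _), Finset.sum_comm]
  simp only [rowWeight, Finset.mul_sum]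

theorem of_coeff_weightedHomogeneousComponent_ne_zero {ν : Type*} {W : ν → ℕ} {n : ℕ}
    {G : MvPowerSeries ν F} {α : ν →₀ ℕ}
    (h : MvPowerSeries.coeff α (MvPowerSeries.weightedHomogeneousComponent W n G) ≠ 0) :
    Finsupp.weight W α = n ∧ MvPowerSeries.coeff α G ≠ 0 := by
  rw [MvPowerSeries.coeff_weightedHomogeneousComponent] at h
  exact ite_ne_right_iff.1 h

theorem summable_weightedHomogeneousComponent {ν : Type*} [Fintype ν] (W : ν → ℕ) (n : ℕ)
    {G : MvPowerSeries ν F} {δ : ℝ} (hδ : 0 ≤ δ)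
    (hG : Summable fun α : ν →₀ ℕ => ‖MvPowerSeries.coeff α G‖ * ∏ i, δ ^ α i) :
    Summable fun α : ν →₀ ℕ =>
      ‖MvPowerSeries.coeff α (MvPowerSeries.weightedHomogeneousComponent W n G)‖ *
        ∏ i, δ ^ α i := by
  refine Summable.of_nonneg_of_le (fun α => by positivity) (fun α => ?_) hG
  refine mul_le_mul_of_nonneg_right ?_ (by positivity)
  rw [MvPowerSeries.coeff_weightedHomogeneousComponent]
  split_ifs
  · exact le_rfl
  · rw [norm_zero]; exact norm_nonneg _

theorem norm_coeff_axisMonomial_baseExponent_le (hden : latentDenominator M ≠ 0)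
    (hπ : ∃ j : θ, π none = Sum.inr j) {t : κ ⊕ μ → F} {r δ : ℝ} (hr : 0 < r)
    (hX : ∀ j : κ ⊕ Option ι,
      ∏ k, discRadius t r k ^ ((transferMatrix M M' ρ π j k : ℚ) : ℝ) < δ)
    {α : κ ⊕ Option ι →₀ ℕ} (hα : latentComponent M α = 0) (i : κ ⊕ μ) (m : ℕ) :
    ‖PowerSeries.coeff m (axisMonomial t i (baseExponent π α))‖ *
      (r ^ m * r ^ Finsupp.weight (rowWeight M') α) ≤ ∏ j, δ ^ α j := by
  have hT := discRadius_pos (θ := θ) t hr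
  have h1 := prod_rpow_of_vecMul (c := 0) hT
    ((toRat_baseExponent_eq (M' := M') (ρ := ρ) hden hπ hα).trans (add_zero _).symm)
  simp only [Pi.zero_apply, Rat.cast_zero, Real.rpow_zero, Finset.prod_const_one, mul_one] at h1
  rw [Fintype.prod_sum_type] at h1
  simp only [Finsupp.sumElim_inl, Finsupp.sumElim_inr, discRadius, Sum.elim_inl, Sum.elim_inr,
    Finsupp.coe_equivFunOnFinite_symm] at h1
  rw [Finset.prod_pow_eq_pow_sum, ← weight_rowWeight] at h1
  calc ‖PowerSeries.coeff m (axisMonomial t i (baseExponent π α))‖ *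
        (r ^ m * r ^ Finsupp.weight (rowWeight M') α)
      = ‖PowerSeries.coeff m (axisMonomial t i (baseExponent π α))‖ * r ^ m *
        r ^ Finsupp.weight (rowWeight M') α := (mul_assoc _ _ _).symm
    _ ≤ (∏ k, (‖t k‖ + r) ^ baseExponent π α k) * r ^ Finsupp.weight (rowWeight M') α :=
        mul_le_mul_of_nonneg_right (norm_coeff_axisMonomial_mul_le t i _ m hr.le) (by positivity)
    _ = _ := h1
    _ ≤ ∏ j, δ ^ α j := by
        refine Finset.prod_le_prod (fun j _ => pow_nonneg (Finset.prod_nonneg fun k _ =>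
          (Real.rpow_pos_of_pos (hT k) _).le) _) fun j _ => pow_le_pow_left₀
          (Finset.prod_nonneg fun k _ => (Real.rpow_pos_of_pos (hT k) _).le) (hX j).le _

theorem summable_axisTerms (hden : latentDenominator M ≠ 0)
    (hπ : ∃ j : θ, π none = Sum.inr j) {t : κ ⊕ μ → F} {r δ : ℝ} (hr : 0 < r)
    (hX : ∀ j : κ ⊕ Option ι,
      ∏ k, discRadius t r k ^ ((transferMatrix M M' ρ π j k : ℚ) : ℝ) < δ) (hδ : 0 ≤ δ)
    {G : MvPowerSeries (κ ⊕ Option ι) F} (hlat : LatentZero M G)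
    (hG : Summable fun α : κ ⊕ Option ι →₀ ℕ => ‖MvPowerSeries.coeff α G‖ * ∏ i, δ ^ α i)
    (n : ℕ) (i : κ ⊕ μ) (m : ℕ) :
    Summable fun α => ‖MvPowerSeries.coeff α
      (MvPowerSeries.weightedHomogeneousComponent (rowWeight M') n G) *
        PowerSeries.coeff m (axisMonomial t i (baseExponent π α))‖ := by
  have hs := summable_weightedHomogeneousComponent (rowWeight M') n hδ hG
  refine Summable.of_nonneg_of_le (fun _ => norm_nonneg _) (fun α => ?_)
    (hs.mul_right (r ^ m * r ^ n)⁻¹)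
  by_cases hα : MvPowerSeries.coeff α
      (MvPowerSeries.weightedHomogeneousComponent (rowWeight M') n G) = 0
  · simp [hα]
  · obtain ⟨h1, h2⟩ := of_coeff_weightedHomogeneousComponent_ne_zero hα
    have h3 := norm_coeff_axisMonomial_baseExponent_le hden hπ hr hX (hlat α h2) i m
    rw [h1] at h3
    rw [norm_mul, mul_assoc]
    refine mul_le_mul_of_nonneg_left ?_ (norm_nonneg _)
    exact (le_mul_inv_iff₀ (by positivity)).2 h3

theorem latentComponent_zero : latentComponent M (0 : κ ⊕ Option ι →₀ ℕ) = 0 := by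
  simp [latentComponent]

theorem latentComponent_single_inl (i : κ) (n : ℕ) :
    latentComponent M (Finsupp.single (Sum.inl i) n) = 0 := by
  simp [latentComponent]

/-- The unit of the Weierstrass form does not vanish on the face: its deviation from the constant `c` is
bounded by its values on a small polydisc. -/
theorem coeff_zero_axisSum_unit_ne_zero [CompleteSpace F] (hden : latentDenominator M ≠ 0)
    (hπ : ∃ j : θ, π none = Sum.inr j) {t : κ ⊕ μ → F} {r δ : ℝ} (hr : 0 < r)
    (hX : ∀ j : κ ⊕ Option ι,
      ∏ k, discRadius t r k ^ ((transferMatrix M M' ρ π j k : ℚ) : ℝ) < δ) (hδ : 0 ≤ δ)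
    {G : MvPowerSeries (κ ⊕ Option ι) F} (hlat : LatentZero M G)
    (hG : Summable fun α : κ ⊕ Option ι →₀ ℕ => ‖MvPowerSeries.coeff α G‖ * ∏ i, δ ^ α i)
    {c : F} (hc : ∑' α : κ ⊕ Option ι →₀ ℕ, ‖MvPowerSeries.coeff α G‖ * ∏ i, δ ^ α i < ‖c‖)
    (i : κ ⊕ μ) :
    PowerSeries.coeff 0 (axisSum t i (baseExponent π)
      (MvPowerSeries.weightedHomogeneousComponent (rowWeight M') 0 (MvPowerSeries.C c + G))) ≠
        0 := by
  classical
  set H := MvPowerSeries.weightedHomogeneousComponent (rowWeight M') 0 G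
  set u : (κ ⊕ Option ι →₀ ℕ) → F := fun α => MvPowerSeries.coeff α H *
    PowerSeries.coeff 0 (axisMonomial t i (baseExponent π α)) with hu
  have hsum : Summable fun α => ‖u α‖ := summable_axisTerms hden hπ hr hX hδ hlat hG 0 i 0
  have h1 : PowerSeries.coeff 0 (axisSum t i (baseExponent π)
      (MvPowerSeries.weightedHomogeneousComponent (rowWeight M') 0 (MvPowerSeries.C c + G))) =
      c + ∑' α, u α := by
    rw [axisSum, PowerSeries.coeff_mk]
    have h2 : ∀ α : κ ⊕ Option ι →₀ ℕ, MvPowerSeries.coeff α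
        (MvPowerSeries.weightedHomogeneousComponent (rowWeight M') 0 (MvPowerSeries.C c + G)) *
          PowerSeries.coeff 0 (axisMonomial t i (baseExponent π α)) =
        (if α = 0 then c else 0) + u α := by
      intro α
      rw [map_add, map_add, add_mul, hu]
      congr 1
      rw [MvPowerSeries.coeff_weightedHomogeneousComponent, MvPowerSeries.coeff_C]
      by_cases hα : α = 0
      · subst hα
        have : baseExponent π (0 : κ ⊕ Option ι →₀ ℕ) = (0 : κ ⊕ μ →₀ ℕ) := by
          ext m; simp [baseExponent_apply]
        simp [this, axisMonomial]
      · simp [hα]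
    rw [tsum_congr h2, Summable.tsum_add ⟨c, hasSum_ite_eq 0 c⟩ hsum.of_norm, tsum_ite_eq]
  rw [h1]
  intro h0
  have h3 : ‖∑' α, u α‖ < ‖c‖ := by
    refine lt_of_le_of_lt (norm_tsum_le_tsum_norm hsum) (lt_of_le_of_lt ?_ hc)
    refine hsum.tsum_le_tsum (fun α => ?_) hG
    by_cases hα : MvPowerSeries.coeff α H = 0
    · simp only [hu, hα, zero_mul, norm_zero]
      positivity
    · obtain ⟨h4, h5⟩ := of_coeff_weightedHomogeneousComponent_ne_zero hα
      have h6 := norm_coeff_axisMonomial_baseExponent_le hden hπ hr hX (hlat α h5) i 0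
      rw [h4, pow_zero, mul_one, mul_one] at h6
      have h7 : MvPowerSeries.coeff α H = MvPowerSeries.coeff α G := by
        rw [MvPowerSeries.coeff_weightedHomogeneousComponent, if_pos h4]
      rw [hu, norm_mul, h7]
      exact mul_le_mul_of_nonneg_left h6 (norm_nonneg _)
  rw [add_eq_zero_iff_eq_neg.1 h0, norm_neg] at h3
  exact lt_irrefl _ h3

/-- The face of a Weierstrass polynomial that contains the leading power is, along the axis, monic of
degree `d` without a term of degree `d - 1`. At a nonzero point it is not a perfect power, so that its
order there is less than `d`. -/
theorem coeff_axisSum_weierstrass_ne_zero [CharZero F] {i₁ : κ} {d : ℕ}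
    {w : MvPowerSeries (κ ⊕ Option ι) F} (hw : IsWeierstrassPolynomial (Sum.inl i₁) d w)
    {t : κ ⊕ μ → F} (ht : t (Sum.inl i₁) ≠ 0) {n : ℕ}
    (hn : Finsupp.weight (rowWeight M') (Finsupp.single (Sum.inl i₁) d) = n) :
    PowerSeries.coeff (d - 1) (axisSum t (Sum.inl i₁) (baseExponent π)
      (MvPowerSeries.weightedHomogeneousComponent (rowWeight M') n w)) ≠ 0 := by
  rw [axisSum, PowerSeries.coeff_mk, tsum_eq_single (Finsupp.single (Sum.inl i₁) d)]
  · rw [MvPowerSeries.coeff_weightedHomogeneousComponent, if_pos hn, hw.coeff_single, one_mul]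
    have h1 : baseExponent π (Finsupp.single (Sum.inl i₁ : κ ⊕ Option ι) d) =
        Finsupp.single (Sum.inl i₁ : κ ⊕ μ) d := by
      ext m
      rw [baseExponent_apply]
      cases m with
      | inl i => simp [rowLabels, Finsupp.single_apply]
      | inr m => simp [rowLabels]
    rw [h1, coeff_axisMonomial]
    refine Finset.prod_ne_zero_iff.2 fun k _ => ?_
    by_cases hk : k = Sum.inl i₁
    · subst hk
      rw [Finsupp.single_eq_same, Finsupp.single_eq_same]
      refine mul_ne_zero (Nat.cast_ne_zero.2 ?_) (pow_ne_zero _ ht)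
      exact (Nat.choose_pos (Nat.sub_le _ _)).ne'
    · simp [Finsupp.single_eq_of_ne hk]
  · intro α hα
    by_cases h1 : MvPowerSeries.coeff α
        (MvPowerSeries.weightedHomogeneousComponent (rowWeight M') n w) = 0
    · rw [h1, zero_mul]
    · rcases hw.eq_single_or (of_coeff_weightedHomogeneousComponent_ne_zero h1).2 with h2 | ⟨h2, -⟩
      · exact absurd h2 hα
      · rw [coeff_axisMonomial_of_lt, mul_zero]
        rw [baseExponent_inl]
        omega

variable {f fI : MvPowerSeries (κ ⊕ Option ι) F}

/-- Sustained latency: the power of `x_1` is constant on the face of the second step, so that all its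
terms have latent component zero if one of them has. -/
theorem latentComponent_eq_zero_of_face (hden : latentDenominator M ≠ 0)
    (hQ : SustainsLatency M M' ρ π) {α α₁ β β₁ : κ ⊕ Option ι →₀ ℕ} {γ γ₁ : (κ ⊕ μ) ⊕ θ →₀ ℕ}
    (h : IsMatched A A' M M' ρ π α β γ) (h₁ : IsMatched A A' M M' ρ π α₁ β₁ γ₁)
    (hγ : ∀ e, γ (Sum.inr e) = 0) (hγ₁ : ∀ e, γ₁ (Sum.inr e) = 0)
    (hα₁ : latentComponent M α₁ = 0) : latentComponent M α = 0 := by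
  obtain ⟨u, hu, hker⟩ := exists_kernel_of_not_isConsistent hQ.inconsistent
  set Q := syntheticMatrix M M' ρ
  have hrow : ∑ e, Q (Sum.inr none) (Sum.inr e) * u e ≠ 0 := by
    intro h0
    refine hQ.det_exc (Matrix.exists_mulVec_eq_zero_iff.1 ⟨u, hu, funext fun e => ?_⟩)
    change ∑ e', Q ((rowLabels π).symm (Sum.inr e)) (Sum.inr e') * u e' = 0
    by_cases hi : ((rowLabels π).symm (Sum.inr e) : κ ⊕ Option ι) = Sum.inr none
    · rw [hi]; exact h0
    · exact hker _ hi
  have hpair : ∀ b : κ ⊕ Option ι → ℚ,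
      ∑ e, Matrix.vecMul b (syntheticReduced M M' ρ π) (Sum.inr e) * u e =
        b (Sum.inr none) * ∑ e, Q (Sum.inr none) (Sum.inr e) * u e := by
    intro b
    have h1 : ∀ e, Matrix.vecMul b (syntheticReduced M M' ρ π) (Sum.inr e) * u e =
        ∑ j, b j * (Q j (Sum.inr e) * u e) := by
      intro e
      rw [syntheticReduced, vecMul_canonicalReduction_inr, Matrix.vecMul, dotProduct,
        Finset.sum_mul]
      exact Finset.sum_congr rfl fun j _ => mul_assoc _ _ _
    rw [Finset.sum_congr rfl fun e _ => h1 e, Finset.sum_comm, Finset.sum_eq_single (Sum.inr none)]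
    · rw [Finset.mul_sum]
    · intro j _ hj
      rw [← Finset.mul_sum, hker j hj, mul_zero]
    · intro hn
      exact absurd (Finset.mem_univ _) hn
  have hnone : toRat β (Sum.inr none) = toRat β₁ (Sum.inr none) := by
    refine mul_right_cancel₀ hrow ?_
    rw [← hpair, ← hpair]
    refine Finset.sum_congr rfl fun e _ => ?_
    rw [h.right, h₁.right]
    simp [toRat, hγ, hγ₁]
  have heq : toRat α = Matrix.vecMul (toRat β - toRat β₁) (interimT M) + toRat α₁ := by
    rw [Matrix.sub_vecMul, h.left, h₁.left]
    abel
  rw [latentComponent_eq_of_vecMul hden heq, Pi.sub_apply, hnone, sub_self, zero_add]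
  exact hα₁

/-- If the leading power `x'_1 ^ d'` is not on the face of the second step, then the restriction to the
exceptional locus has degree less than `d'` in `t'_1`. -/
theorem coeff_onAxis_eq_zero_of_leading_not_mem_face
    (hc : Corresponds (interimB M) (excFactor M A) fI f)
    (hexp : IsExponentialMatrix f A' M') {i₁ : κ} {d : ℕ}
    (hlead : MvPowerSeries.coeff (Finsupp.single (Sum.inl i₁) d) f ≠ 0) {e : θ}
    (he : ∑ j, A' j * M' j (Sum.inr e) ≠
      ∑ j, Finsupp.single (Sum.inl i₁ : κ ⊕ Option ι) d j * M' j (Sum.inr e))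
    (t : κ ⊕ μ → F) {m : ℕ} (hm : d ≤ m) :
    PowerSeries.coeff m (onAxis (Sum.inl i₁)
      (proper (localize t (syntheticTransform fI A A' M M' ρ π)))) = 0 := by
  have hlt := lt_of_le_of_ne (hexp.sum_le_sum hlead (Sum.inr e)) he
  rw [coeff_onAxis_proper_localize]
  rw [← tsum_zero (α := F) (β := κ ⊕ μ →₀ ℕ)]
  refine tsum_congr fun η => ?_
  by_cases hη : MvPowerSeries.coeff (Finsupp.sumElim η 0)
      (syntheticTransform fI A A' M M' ρ π) = 0
  · rw [hη, zero_mul]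
  · obtain ⟨α, β, hm'⟩ := exists_isMatched_of_coeff_syntheticTransform_ne_zero hc hexp hη
    have h1 := hm'.apply_inr e
    rw [Finsupp.sumElim_inr, Finsupp.coe_zero, Pi.zero_apply, zero_add] at h1
    rw [h1] at hlt
    have h2 : ∑ j, Finsupp.single (Sum.inl i₁ : κ ⊕ Option ι) d j * M' j (Sum.inr e) =
        d * M' (Sum.inl i₁) (Sum.inr e) := by
      rw [Finset.sum_eq_single (Sum.inl i₁)]
      · rw [Finsupp.single_eq_same]
      · intro j _ hj
        rw [Finsupp.single_eq_of_ne hj, zero_mul]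
      · intro hn
        exact absurd (Finset.mem_univ _) hn
    rw [h2] at hlt
    have h3 : α (Sum.inl i₁) * M' (Sum.inl i₁) (Sum.inr e) < d * M' (Sum.inl i₁) (Sum.inr e) :=
      lt_of_le_of_lt (Finset.single_le_sum (f := fun j => α j * M' j (Sum.inr e))
        (fun _ _ => Nat.zero_le _) (Finset.mem_univ _)) hlt
    have h4 : η (Sum.inl i₁) = α (Sum.inl i₁) := by
      rw [← hm'.apply_inl_left i₁, ← Finsupp.sumElim_inl η (0 : θ →₀ ℕ), hm'.apply_inl]
      rfl
    rw [coeff_axisMonomial_of_lt, mul_zero]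
    rw [h4]
    exact lt_of_lt_of_le (lt_of_mul_lt_mul_right h3 (Nat.zero_le _)) hm

/-- If the leading power `x'_1 ^ d'` is on the face of the second step, then the restriction to the
exceptional locus is, up to a monomial in the other variables, the face of the latent reducible
function. -/
theorem onAxis_eq_axisSum_of_leading_mem_face (hden : latentDenominator M ≠ 0)
    (hc : Corresponds (interimB M) (excFactor M A) fI f)
    (hexp : IsExponentialMatrix f A' M') (hQ : SustainsLatency M M' ρ π) {i₁ : κ} {d : ℕ}
    (hlead : MvPowerSeries.coeff (Finsupp.single (Sum.inl i₁) d) f ≠ 0)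
    (hface : ∀ e, ∑ j, A' j * M' j (Sum.inr e) =
      ∑ j, Finsupp.single (Sum.inl i₁ : κ ⊕ Option ι) d j * M' j (Sum.inr e))
    {t : κ ⊕ μ → F} (ht : ∀ m, t m ≠ 0) :
    ∃ c : F, c ≠ 0 ∧ onAxis (Sum.inl i₁)
      (proper (localize t (syntheticTransform fI A A' M M' ρ π))) =
        axisSum t (Sum.inl i₁) (baseExponent π) (MvPowerSeries.weightedHomogeneousComponent
          (rowWeight M') (Finsupp.weight (rowWeight M') A') (latentReducible M f)) *
          PowerSeries.C c := by
  set D : κ ⊕ Option ι →₀ ℕ := Finsupp.single (Sum.inl i₁) d with hD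
  set p := syntheticTransform fI A A' M M' ρ π with hp
  set Φ := MvPowerSeries.weightedHomogeneousComponent (rowWeight M')
    (Finsupp.weight (rowWeight M') A') (latentReducible M f) with hΦ
  have hΦcoeff : ∀ α, MvPowerSeries.coeff α Φ ≠ 0 →
      Finsupp.weight (rowWeight M') α = Finsupp.weight (rowWeight M') A' ∧
      latentComponent M α = 0 ∧ MvPowerSeries.coeff α f = MvPowerSeries.coeff α Φ := by
    intro α hα
    obtain ⟨h1, h2⟩ := of_coeff_weightedHomogeneousComponent_ne_zero hα
    have h3 : MvPowerSeries.coeff α (latentReducible M f) =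
        if latentComponent M α = 0 then MvPowerSeries.coeff α f else 0 := rfl
    rw [h3] at h2
    have h4 := (ite_ne_right_iff.1 h2).1
    refine ⟨h1, h4, ?_⟩
    rw [hΦ, MvPowerSeries.coeff_weightedHomogeneousComponent, if_pos h1, h3, if_pos h4]
  obtain ⟨β₁, γ₁, hm₁⟩ := exists_isMatched_of_coeff_ne_zero (A := A) (A' := A') (M' := M') (ρ := ρ)
    (π := π) hden hc hexp hlead
  have hγ₁ : ∀ e, γ₁ (Sum.inr e) = 0 := by
    intro e
    have := hm₁.apply_inr e
    rw [hface e] at this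
    omega
  -- on the face, the exponents of `T'_*` exceed those of the corresponding variables `X'` by `c₀`
  set c₀ : κ ⊕ μ →₀ ℕ := baseExponent π β₁ - baseExponent π D with hc₀
  have hshift : ∀ {α β γ}, IsMatched A A' M M' ρ π α β γ → (∀ e, γ (Sum.inr e) = 0) →
      latentComponent M α = 0 ∧ γ = Finsupp.sumElim (baseExponent π α + c₀) 0 := by
    intro α β γ hm hγ
    have hlat := latentComponent_eq_zero_of_face hden hQ hm hm₁ hγ hγ₁
      (latentComponent_single_inl i₁ d)
    refine ⟨hlat, ?_⟩
    have hb : toRat β - toRat β₁ =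
        toRat (α.erase (Sum.inr none)) - toRat (D.erase (Sum.inr none)) := by
      apply (vecMul_interimT_bijective hden).1
      simp only [Matrix.sub_vecMul]
      rw [← toRat_eq_vecMul_of_latentComponent_eq_zero hden hlat,
        ← toRat_eq_vecMul_of_latentComponent_eq_zero hden (latentComponent_single_inl i₁ d),
        hm.left, hm₁.left]
      abel
    ext k
    cases k with
    | inr e => simpa using hγ e
    | inl m =>
      have hne := rowLabels_symm_inl_ne_none (κ := κ) hQ.label m
      have h1 := congrFun hb ((rowLabels π).symm (Sum.inl m))
      simp only [toRat, Pi.sub_apply, Finsupp.erase_ne hne] at h1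
      have h2 : β ((rowLabels π).symm (Sum.inl m)) + D ((rowLabels π).symm (Sum.inl m)) =
          α ((rowLabels π).symm (Sum.inl m)) + β₁ ((rowLabels π).symm (Sum.inl m)) := by
        have : (β ((rowLabels π).symm (Sum.inl m)) : ℚ) + D ((rowLabels π).symm (Sum.inl m)) =
          α ((rowLabels π).symm (Sum.inl m)) + β₁ ((rowLabels π).symm (Sum.inl m)) := by linarith
        exact_mod_cast this
      have h3 : D ((rowLabels π).symm (Sum.inl m)) ≤ β₁ ((rowLabels π).symm (Sum.inl m)) := by
        cases m with
        | inl i => exact (hm₁.apply_inl_left i).ge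
        | inr m =>
          have : D ((rowLabels π).symm (Sum.inl (Sum.inr m))) = 0 := by simp [hD, rowLabels]
          omega
      rw [hm.apply_inl, Finsupp.sumElim_inl, Finsupp.add_apply, hc₀, Finsupp.tsub_apply,
        baseExponent_apply, baseExponent_apply, baseExponent_apply]
      omega
  have hc₀i : c₀ (Sum.inl i₁) = 0 := by
    rw [hc₀, Finsupp.tsub_apply, baseExponent_inl, baseExponent_inl, hm₁.apply_inl_left, tsub_self]
  have hmatchΦ : ∀ α, MvPowerSeries.coeff α Φ ≠ 0 → ∃ β,
      IsMatched A A' M M' ρ π α β (Finsupp.sumElim (baseExponent π α + c₀) 0) := by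
    intro α hα
    obtain ⟨h1, h2, h3⟩ := hΦcoeff α hα
    obtain ⟨β, γ, hm⟩ := exists_isMatched_of_coeff_ne_zero (A := A) (A' := A') (M' := M') (ρ := ρ)
      (π := π) hden hc hexp (h3.trans_ne hα)
    have hγ : ∀ e, γ (Sum.inr e) = 0 := by
      rw [weight_rowWeight, weight_rowWeight, eq_comm] at h1
      have h4 := (Finset.sum_eq_sum_iff_of_le fun e _ =>
        hexp.sum_le_sum (h3.trans_ne hα) (Sum.inr e)).1 h1
      intro e
      have h5 := hm.apply_inr e
      have h6 := h4 e (Finset.mem_univ e)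
      omega
    have := (hshift hm hγ).2
    rw [← this]
    exact ⟨β, hm⟩
  refine ⟨∏ k, t k ^ c₀ k, Finset.prod_ne_zero_iff.2 fun k _ => pow_ne_zero _ (ht k), ?_⟩
  ext m
  rw [coeff_onAxis_proper_localize, mul_comm, PowerSeries.coeff_C_mul, axisSum,
    PowerSeries.coeff_mk, ← tsum_mul_left]
  have hval : ∀ α, MvPowerSeries.coeff α Φ ≠ 0 →
      MvPowerSeries.coeff (Finsupp.sumElim (baseExponent π α + c₀) 0) p *
        PowerSeries.coeff m (axisMonomial t (Sum.inl i₁) (baseExponent π α + c₀)) =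
      (∏ k, t k ^ c₀ k) * (MvPowerSeries.coeff α Φ *
        PowerSeries.coeff m (axisMonomial t (Sum.inl i₁) (baseExponent π α))) := by
    intro α hα
    obtain ⟨β, hm⟩ := hmatchΦ α hα
    rw [hp, coeff_syntheticTransform hc hexp hQ hm, (hΦcoeff α hα).2.2, axisMonomial_add,
      axisMonomial_of_apply_eq_zero t hc₀i, mul_comm (axisMonomial _ _ _), PowerSeries.coeff_C_mul]
    ring
  have hsupp : ∀ α : Function.support (fun α => (∏ k, t k ^ c₀ k) * (MvPowerSeries.coeff α Φ *
      PowerSeries.coeff m (axisMonomial t (Sum.inl i₁) (baseExponent π α)))),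
      MvPowerSeries.coeff α.1 Φ ≠ 0 :=
    fun α => left_ne_zero_of_mul (right_ne_zero_of_mul α.2)
  refine tsum_eq_tsum_of_ne_zero_bij (fun α => baseExponent π α.1 + c₀) ?_ ?_ ?_
  · intro α α' h
    obtain ⟨β, hm⟩ := hmatchΦ α.1 (hsupp α)
    obtain ⟨β', hm'⟩ := hmatchΦ α'.1 (hsupp α')
    dsimp only at h
    rw [← h] at hm'
    exact Subtype.ext (hm.eq_of_right hQ hm')
  · intro η hη
    have hη' : MvPowerSeries.coeff (Finsupp.sumElim η 0) p ≠ 0 := left_ne_zero_of_mul hη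
    obtain ⟨α, β, hm⟩ := exists_isMatched_of_coeff_syntheticTransform_ne_zero hc hexp hη'
    obtain ⟨hlat, hγ⟩ := hshift hm fun e => by simp
    have hηα : η = baseExponent π α + c₀ := by
      ext k
      simpa using DFunLike.congr_fun hγ (Sum.inl k)
    have hw : Finsupp.weight (rowWeight M') α = Finsupp.weight (rowWeight M') A' := by
      rw [weight_rowWeight, weight_rowWeight]
      refine Finset.sum_congr rfl fun e _ => ?_
      have := hm.apply_inr e
      simpa using this.symm
    have hα : MvPowerSeries.coeff α Φ ≠ 0 := by
      rw [hΦ, MvPowerSeries.coeff_weightedHomogeneousComponent, if_pos hw]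
      change (if latentComponent M α = 0 then MvPowerSeries.coeff α f else 0) ≠ 0
      rw [if_pos hlat, ← coeff_syntheticTransform hc hexp hQ hm]
      exact hη'
    refine ⟨⟨α, ?_⟩, hηα.symm⟩
    rw [Function.mem_support, ← hval α hα, ← hηα]
    exact hη
  · intro α
    exact hval α.1 (hsupp α)

end OrderEstimate

end LatentResolution

open LatentResolution in
theorem mainTheorem9 {F : Type*} [NormedField F] [CompleteSpace F] [CharZero F]
    {κ ι μ θ : Type*} [Fintype κ] [DecidableEq κ] [Fintype ι] [DecidableEq ι]
    [Fintype μ] [DecidableEq μ] [Fintype θ] [DecidableEq θ]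
    -- the first step, in which `x_1` is inconsistent and becomes latent
    (w : MvPowerSeries (κ ⊕ Option ι) F) (d : ℕ) (A : (κ ⊕ Option ι) →₀ ℕ)
    (M : Matrix (κ ⊕ Option ι) (κ ⊕ Option ι) ℕ)
    (hM : LatentResolution.IsInconsistentStep w d A M)
    -- the latent reductions, with new primary variable `x'_1` of singularity height `d'`
    (s : κ → F) (i₁ : κ) (g : Matrix κ κ F) (h : MvPowerSeries (κ ⊕ Option ι) F) (d' : ℕ)
    (hred : LatentResolution.IsLatentReduction w A M s i₁ g h d')
    -- the second step, with which `x'_1` is consistent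
    (A' : (κ ⊕ Option ι) →₀ ℕ) (M' : Matrix (κ ⊕ Option ι) ((κ ⊕ μ) ⊕ θ) ℕ)
    (ρ : Option ι ≃ μ ⊕ θ)
    (hM' : LatentResolution.IsConsistentStep
      (LatentResolution.latentForm w A M s i₁ g h) i₁ A' M' ρ)
    -- `x_1` sustains its latency with respect to `Q'`
    (π : Option ι ≃ μ ⊕ θ)
    (hQ : LatentResolution.SustainsLatency M M' ρ π)
    -- the partial transform `p` of the interim transform under `N_{Q'}`
    (p : MvPowerSeries ((κ ⊕ μ) ⊕ θ) F)
    (hp : p = LatentResolution.syntheticTransform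
      (LatentResolution.interimTransform w M s i₁ g h) A A' M M' ρ π) :
    ∃ δ : ℝ, 0 < δ ∧ ∀ t : κ ⊕ μ → F, (∀ m, t m ≠ 0) →
      (∀ j, LatentResolution.IsDeficient M' j →
        LatentResolution.modulus M M' ρ π t j < δ) →
      LatentResolution.ConvergesAt p (Sum.elim t 0) ∧
      (LatentResolution.onAxis (Sum.inl i₁)
          (LatentResolution.proper (LatentResolution.localize t p)) ≠ 0 →
        (LatentResolution.onAxis (Sum.inl i₁)
          (LatentResolution.proper (LatentResolution.localize t p))).order < d' ∧
        (LatentResolution.proper (LatentResolution.localize t p)).order < d') := by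
  have hden := hM.denominator_ne_zero
  have hexp := hM'.exponential
  have hc := interimTransform_corresponds hM s i₁ g hred.h_const hred.h_latent
  have hf_conv := hred.f_conv
  obtain ⟨c, w', r, hc0, hw', hr0, hw'conv, hrconv, hw'lat, hrlat, hform⟩ := hred.weierstrass
  set f := latentForm w A M s i₁ g h
  -- the singularity height is positive, as the localized proper transform vanishes at the origin
  have hd' : d' ≠ 0 := by
    rintro rfl
    obtain ⟨⟨α, hα, hdeg⟩, -⟩ := MvPowerSeries.order_eq_nat.1 hred.height
    rw [(Finsupp.degree_eq_zero_iff α).1 hdeg,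
      MvPowerSeries.coeff_zero_eq_constantCoeff_apply] at hα
    exact hα hred.branch.vanishes
  have hlead : MvPowerSeries.coeff (Finsupp.single (Sum.inl i₁) d') f ≠ 0 := by
    have h1 : MvPowerSeries.coeff (Finsupp.single (Sum.inl i₁) d') (latentReducible M f) =
        MvPowerSeries.coeff (Finsupp.single (Sum.inl i₁) d') f :=
      if_pos (latentComponent_single_inl i₁ d')
    rw [← h1, hform, hw'.coeff_single_mul, map_add, hr0, add_zero,
      MvPowerSeries.constantCoeff_C]
    exact hc0
  obtain ⟨ρf, hρf, hsf⟩ := hf_conv.exists_radius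
  obtain ⟨ρw, hρw, hsw⟩ := hw'conv.exists_radius
  obtain ⟨ρr, hρr, hsr⟩ := hrconv.exists_radius_tsum_lt hr0 (norm_pos_iff.2 hc0)
  set δ := min ρf (min ρw ρr)
  have hδ : 0 < δ := lt_min hρf (lt_min hρw hρr)
  have hδf := summable_of_le_radius hδ.le (min_le_left _ _) hsf
  have hδw := summable_of_le_radius hδ.le ((min_le_right _ _).trans (min_le_left _ _)) hsw
  obtain ⟨hδr, hδc⟩ := hsr δ hδ ((min_le_right _ _).trans (min_le_right _ _))
  refine ⟨δ, hδ, fun t ht hmod => ?_⟩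
  obtain ⟨ε, hε, hX⟩ := exists_radius hden ht hδ hmod
  subst hp
  refine ⟨convergesAt_syntheticTransform hden hc hexp hQ hδf hε hX, fun hreg => ?_⟩
  set p := syntheticTransform (interimTransform w M s i₁ g h) A A' M M' ρ π
  -- the two cases: whether or not `x'_1 ^ d'` is on the face of the second step
  obtain ⟨m, hm, hmne⟩ : ∃ m < d',
      PowerSeries.coeff m (onAxis (Sum.inl i₁) (proper (localize t p))) ≠ 0 := by
    by_cases hface : ∀ e, ∑ j, A' j * M' j (Sum.inr e) =
        ∑ j, Finsupp.single (Sum.inl i₁ : κ ⊕ Option ι) d' j * M' j (Sum.inr e)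
    · obtain ⟨c₁, hc₁, heq⟩ :=
        onAxis_eq_axisSum_of_leading_mem_face hden hc hexp hQ hlead hface ht
      set n := Finsupp.weight (rowWeight M') A' with hn
      have hweight : Finsupp.weight (rowWeight M') (Finsupp.single (Sum.inl i₁) d') = n := by
        rw [hn, weight_rowWeight, weight_rowWeight]
        exact Finset.sum_congr rfl fun e _ => (hface e).symm
      -- the unit has weighted order zero, so `w'` and `f_0` have the same weighted order
      have hU0 : MvPowerSeries.weightedOrder (rowWeight M') (MvPowerSeries.C c + r) = 0 := by
        have := MvPowerSeries.weightedOrder_le (rowWeight M') (f := MvPowerSeries.C c + r) (d := 0)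
          (by simpa [hr0] using hc0)
        simpa using this
      have hw'order : (n : ℕ∞) ≤ MvPowerSeries.weightedOrder (rowWeight M') w' := by
        have h1 := MvPowerSeries.weightedOrder_mul (rowWeight M') w' (MvPowerSeries.C c + r)
        rw [hU0, add_zero, ← hform] at h1
        rw [← h1]
        refine MvPowerSeries.nat_le_weightedOrder _ fun α hα => ?_
        by_contra hne
        have h2 : MvPowerSeries.coeff α f ≠ 0 := fun h0 => hne (by
          change (if latentComponent M α = 0 then MvPowerSeries.coeff α f else 0) = 0
          rw [h0, ite_self])
        refine absurd hα (not_lt.2 ?_)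
        rw [hn, weight_rowWeight, weight_rowWeight]
        exact Finset.sum_le_sum fun e _ => hexp.sum_le_sum h2 _
      have hU0' : ((0 : ℕ) : ℕ∞) ≤
          MvPowerSeries.weightedOrder (rowWeight M') (MvPowerSeries.C c + r) := by simp
      have hmul := MvPowerSeries.weightedHomogeneousComponent_mul_of_le_weightedOrder
        hw'order hU0'
      rw [add_zero, ← hform] at hmul
      have hUlat : LatentZero M (MvPowerSeries.C c + r) := by
        classical
        intro α hα
        by_cases h0 : α = 0
        · rw [h0]; exact latentComponent_zero
        · refine hrlat α ?_
          rwa [map_add, MvPowerSeries.coeff_C, if_neg h0, zero_add] at hα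
      have hUs : Summable fun α : κ ⊕ Option ι →₀ ℕ =>
          ‖MvPowerSeries.coeff α (MvPowerSeries.C c + r)‖ * ∏ i, δ ^ α i := by
        classical
        have h1 : Summable fun α : κ ⊕ Option ι →₀ ℕ => if α = 0 then ‖c‖ else 0 :=
          ⟨_, hasSum_ite_eq 0 ‖c‖⟩
        refine Summable.of_nonneg_of_le (fun α => by positivity) (fun α => ?_) (h1.add hδr)
        rw [map_add, MvPowerSeries.coeff_C]
        by_cases h0 : α = 0
        · subst h0
          simpa using norm_add_le _ _
        · simp [h0]
      rw [hmul, axisSum_mul t _ baseExponent_add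
        (fun m => summable_axisTerms hden hQ.label hε hX hδ.le hw'lat hδw n _ m)
        (fun m => summable_axisTerms hden hQ.label hε hX hδ.le hUlat hUs 0 _ m)] at heq
      -- the orders of the three factors add up to at most `d' - 1`
      by_contra! hall
      have h1 : (d' : ℕ∞) ≤ (onAxis (Sum.inl i₁) (proper (localize t p))).order :=
        PowerSeries.nat_le_order _ _ hall
      have h2 := PowerSeries.order_le _
        (coeff_axisSum_weierstrass_ne_zero (π := π) hw' (ht (Sum.inl i₁)) hweight)
      have h3 := PowerSeries.order_le _ (coeff_zero_axisSum_unit_ne_zero (π := π) hden hQ.label hε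
        hX hδ.le hrlat hδr hδc (Sum.inl i₁))
      have h4 := PowerSeries.order_le (φ := PowerSeries.C c₁) 0 (by simpa using hc₁)
      rw [heq, PowerSeries.order_mul, PowerSeries.order_mul] at h1
      have h5 := h1.trans (add_le_add (add_le_add h2 h3) h4)
      have h6 : d' ≤ d' - 1 := by
        simp only [Nat.cast_zero, add_zero] at h5
        exact_mod_cast h5
      omega
    · push Not at hface
      obtain ⟨e, he⟩ := hface
      by_contra! hall
      refine hreg (PowerSeries.ext fun m => ?_)
      rw [map_zero]
      rcases lt_or_ge m d' with hlt | hge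
      · exact hall m hlt
      · exact coeff_onAxis_eq_zero_of_leading_not_mem_face hc hexp hlead he t hge
  have hmd : (m : ℕ∞) < d' := by exact_mod_cast hm
  refine ⟨(PowerSeries.order_le m hmne).trans_lt hmd, ?_⟩
  rw [onAxis, PowerSeries.coeff_mk] at hmne
  refine (MvPowerSeries.order_le hmne).trans_lt ?_
  rwa [Finsupp.degree_single]
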